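/- A set partition of $[n]=\{1,\dots,n\}$ ($n\ge 0$) is a set $A$ of pairwise disjoint nonempty subsets (parts) of $[n]$ with union $[n]$; write $|A|=n$ and let $\ell(A)$ be its number of parts. For $A\vdash[n]$ and $B\vdash[m]$ let $A|B\vdash[n+m]$ consist of the parts of $A$ together with the parts of $B$ with $n$ added to every entry. Call $A$ atomic if $|A|>0$ and $A\neq B|C$ for all set partitions $B,C$ with $|B|,|C|>0$. Every $A$ is uniquely $A=A^{(1)}|\cdots|A^{(d)}$ with all $A^{(i)}$ atomic; put $A^!=(A^{(1)},\dots,A^{(d)})$. Order set partitions totally by: $A<B$ if $|A|<|B|$; or $|A|=|B|$ and $\ell(A)<\ell(B)$; or $|A|=|B|$, $\ell(A)=\ell(B)$ and $w(A)<_{lex}w(B)$, where $w(A)$ is the word of length $n=|A|$ with $w(A)_i=j$ if $i\in A_j$, the parts $A_1,A_2,\dots$ of $A$ being listed by increasing least element. A nonempty word in a totally ordered alphabet is Lyndon if it is lexicographically strictly smaller than each of its nontrivial cyclic shifts. Call $A$ Lyndon if $A^!$ is a Lyndon word in the alphabet of atomic set partitions. Let $K$ be a field of characteristic $0$. Let $NCSym^*$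 be the graded dual of $NCSym$, that is, the commutative $K$-algebra with basis $\{\mathbf w_A\}$ indexed by all set partitions, unit $\mathbf w_\emptyset$, and product, for $A\vdash[n]$, $B\vdash[m]$, $$\mathbf w_A\mathbf w_B=\sum_{S\subseteq[n+m],\ |S|=n}\mathbf w_{A\uparrow_S\,\cup\,B\uparrow_{[n+m]\setminus S}},$$ where $A\uparrow_S$ is obtained from $A$ by replacing its entries by the elements of $S$, keeping the relative order. (This product is dual to the coproduct $\Delta(\mathbf m_C)=\sum_T \mathbf m_{st(T)}\otimes\mathbf m_{st(C\setminus T)}$ of $NCSym$, over all sets $T$ of parts of $C$, where $st$ lowers the entries to $1,2,\dots$ keeping their relative order.) **Theorem.** The algebra $NCSym^*$ is freely generated, as a commutative $K$-algebra, by the elements $$\{\mathbf w_B \mid B\vdash[n],\ n\ge 0,\ B \text{ is Lyndon}\};$$ that is, these elements are algebraically independent over $K$ and generate $NCSym^*$ as a $K$-algebra. -/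

import Mathlib

/-- A word in a totally ordered alphabet is Lyndon if it is nonempty and lexicographically
strictly smaller than all its nontrivial cyclic shifts. -/
def IsLyndonWord {α : Type*} [LinearOrder α] (w : List α) : Prop :=
  w ≠ [] ∧ ∀ i, 0 < i → i < w.length → w < w.rotate i

/-- A set partition of `[n] = {1, …, n}`, where `n` is its `size` (`n = 0` is allowed). -/
structure SetPartition where
  size : ℕ
  toFinpartition : Finpartition (Finset.Icc 1 size)

namespace SetPartition

/-- The set of parts. -/
def parts (A : SetPartition) : Finset (Finset ℕ) := A.toFinpartition.parts

/-- `ℓ(A)`, the number of parts. -/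
def length (A : SetPartition) : ℕ := A.parts.card

theorem empty_notMem (A : SetPartition) : ∅ ∉ A.parts := A.toFinpartition.bot_notMem

theorem eq_of_mem {A : SetPartition} {p q : Finset ℕ} {x : ℕ} (hp : p ∈ A.parts)
    (hq : q ∈ A.parts) (hxp : x ∈ p) (hxq : x ∈ q) : p = q :=
  A.toFinpartition.eq_of_mem_parts hp hq hxp hxq

theorem biUnion_parts (A : SetPartition) : A.parts.biUnion id = Finset.Icc 1 A.size :=
  A.toFinpartition.biUnion_parts

theorem mem_cover (A : SetPartition) {x : ℕ} :
    (∃ p ∈ A.parts, x ∈ p) ↔ 1 ≤ x ∧ x ≤ A.size := by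
  rw [← Finset.mem_Icc, ← A.biUnion_parts]
  simp

theorem subset_Icc {A : SetPartition} {p : Finset ℕ} (hp : p ∈ A.parts) :
    p ⊆ Finset.Icc 1 A.size := by
  rw [← A.biUnion_parts]
  exact Finset.subset_biUnion_of_mem id hp

theorem ext_parts {A B : SetPartition} (h : A.parts = B.parts) : A = B := by
  have hs : A.size = B.size := by
    have := congrArg (fun P : Finset (Finset ℕ) => (P.biUnion id).card) h
    simpa [biUnion_parts] using this
  obtain ⟨n, P⟩ := A
  obtain ⟨m, Q⟩ := B
  obtain rfl : n = m := hs
  congr 1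
  exact Finpartition.ext h

/-- The set partition with a given set of parts. -/
def ofParts (n : ℕ) (P : Finset (Finset ℕ)) (h0 : ∅ ∉ P)
    (hd : ∀ p ∈ P, ∀ q ∈ P, ∀ x ∈ p, x ∈ q → p = q)
    (hc : P.biUnion id = Finset.Icc 1 n) : SetPartition where
  size := n
  toFinpartition :=
    { parts := P
      supIndep := by
        rw [Finset.supIndep_iff_pairwiseDisjoint]
        intro p hp q hq hne
        exact Finset.disjoint_left.2 fun x hx hx' => hne (hd p hp q hq x hx hx')
      sup_parts := by rw [← hc, Finset.sup_eq_biUnion]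
      bot_notMem := h0 }

@[simp] theorem parts_ofParts (n P h0 hd hc) : (ofParts n P h0 hd hc).parts = P := rfl
@[simp] theorem size_ofParts (n P h0 hd hc) : (ofParts n P h0 hd hc).size = n := rfl

/-- The set partition of `[0] = ∅`. -/
def empty : SetPartition := ofParts 0 ∅ (by simp) (by simp) (by simp)

theorem eq_empty {A : SetPartition} (h : A.size = 0) : A = empty := by
  apply ext_parts
  change A.parts = ∅
  apply Finset.eq_empty_of_forall_notMem
  intro p hp
  have h1 := subset_Icc hp
  rw [h] at h1
  have h2 : p = ∅ := by simpa using h1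
  exact A.empty_notMem (h2 ▸ hp)

/-- `A | B`: the parts of `A` together with the parts of `B` shifted by `|A|`. -/
def slash (A B : SetPartition) : SetPartition :=
  ofParts (A.size + B.size)
    (A.parts ∪ B.parts.image (Finset.image (· + A.size)))
    (by
      simp only [Finset.mem_union, Finset.mem_image, Finset.image_eq_empty, not_or]
      refine ⟨A.empty_notMem, ?_⟩
      rintro ⟨p, hp, rfl⟩
      exact B.empty_notMem hp)
    (by
      intro p hp q hq x hx hx'
      simp only [Finset.mem_union, Finset.mem_image] at hp hq
      rcases hp with hp | ⟨p, hp, rfl⟩ <;> rcases hq with hq | ⟨q, hq, rfl⟩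
      · exact eq_of_mem hp hq hx hx'
      · have := Finset.mem_Icc.1 (subset_Icc hp hx)
        obtain ⟨y, hy, rfl⟩ := Finset.mem_image.1 hx'
        have := Finset.mem_Icc.1 (subset_Icc hq hy)
        omega
      · have := Finset.mem_Icc.1 (subset_Icc hq hx')
        obtain ⟨y, hy, rfl⟩ := Finset.mem_image.1 hx
        have := Finset.mem_Icc.1 (subset_Icc hp hy)
        omega
      · obtain ⟨y, hy, rfl⟩ := Finset.mem_image.1 hx
        obtain ⟨z, hz, hzy⟩ := Finset.mem_image.1 hx'
        obtain rfl : z = y := by simpa using hzy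
        rw [eq_of_mem hp hq hy hz])
    (by
      ext x
      simp only [Finset.mem_biUnion, Finset.mem_union, Finset.mem_image, id, Finset.mem_Icc]
      constructor
      · rintro ⟨p, hp | ⟨p, hp, rfl⟩, hx⟩
        · have := Finset.mem_Icc.1 (subset_Icc hp hx)
          omega
        · obtain ⟨y, hy, rfl⟩ := Finset.mem_image.1 hx
          have := Finset.mem_Icc.1 (subset_Icc hp hy)
          omega
      · rintro ⟨h1, h2⟩
        by_cases h : x ≤ A.size
        · obtain ⟨p, hp, hx⟩ := A.mem_cover.2 ⟨h1, h⟩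
          exact ⟨p, Or.inl hp, hx⟩
        · obtain ⟨p, hp, hx⟩ := (B.mem_cover (x := x - A.size)).2 ⟨by omega, by omega⟩
          exact ⟨_, Or.inr ⟨p, hp, rfl⟩, Finset.mem_image.2 ⟨_, hx, by omega⟩⟩)

@[simp] theorem size_slash (A B : SetPartition) : (slash A B).size = A.size + B.size := rfl

theorem parts_slash (A B : SetPartition) :
    (slash A B).parts = A.parts ∪ B.parts.image (Finset.image (· + A.size)) := rfl

/-- `A` is atomic: nonempty, and not of the form `B | C` with `B` and `C` nonempty. -/
def IsAtomic (A : SetPartition) : Prop :=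
  A.size ≠ 0 ∧ ¬ ∃ B C : SetPartition, B.size ≠ 0 ∧ C.size ≠ 0 ∧ A = slash B C

/-- `A⁽¹⁾ | A⁽²⁾ | ⋯ | A⁽ᵈ⁾`. -/
def concat (L : List SetPartition) : SetPartition := L.foldr slash empty

@[simp] theorem size_empty : empty.size = 0 := rfl
@[simp] theorem parts_empty : empty.parts = ∅ := rfl

theorem slash_assoc (A B C : SetPartition) : slash (slash A B) C = slash A (slash B C) := by
  apply ext_parts
  simp only [parts_slash, size_slash, Finset.image_union, Finset.union_assoc, Finset.image_image]
  congr 3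
  funext p
  simp only [Function.comp, Finset.image_image]
  congr 1
  funext x
  simp only [Function.comp]
  omega

theorem empty_slash (A : SetPartition) : slash empty A = A := by
  apply ext_parts
  have h : (Finset.image fun x : ℕ => x) = id := by
    funext p
    simp
  simp [parts_slash, h]

theorem slash_empty (A : SetPartition) : slash A empty = A := by
  apply ext_parts
  simp [parts_slash]

theorem concat_append (L M : List SetPartition) :
    concat (L ++ M) = slash (concat L) (concat M) := by
  induction L with
  | nil => simp [concat, empty_slash]
  | cons A L ih =>
    change slash A (concat (L ++ M)) = slash (slash A (concat L)) (concat M)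
    rw [ih, slash_assoc]

theorem exists_split (A : SetPartition) : ∃ L : List SetPartition, (∀ a ∈ L, a.IsAtomic) ∧ concat L = A := by
  induction h : A.size using Nat.strong_induction_on generalizing A with
  | _ n ih =>
    by_cases h0 : A.size = 0
    · exact ⟨[], by simp, (eq_empty h0).symm⟩
    by_cases ha : A.IsAtomic
    · exact ⟨[A], by simpa using ha, slash_empty A⟩
    · simp only [IsAtomic, not_and, not_not] at ha
      obtain ⟨B, C, hB, hC, rfl⟩ := ha h0
      rw [size_slash] at h
      obtain ⟨L, hL, rfl⟩ := ih B.size (by omega) B rfl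
      obtain ⟨M, hM, rfl⟩ := ih C.size (by omega) C rfl
      refine ⟨L ++ M, ?_, concat_append L M⟩
      intro a haa
      rcases List.mem_append.1 haa with h | h
      · exact hL a h
      · exact hM a h

theorem mem_slash_left {A B : SetPartition} {q : Finset ℕ} (hq : q ⊆ Finset.Icc 1 A.size) :
    q ∈ (slash A B).parts ↔ q ∈ A.parts := by
  rw [parts_slash, Finset.mem_union, or_iff_left]
  rintro h
  obtain ⟨p, hp, rfl⟩ := Finset.mem_image.1 h
  obtain ⟨x, hx⟩ := Finset.nonempty_iff_ne_empty.2 (fun h => B.empty_notMem (h ▸ hp))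
  have h1 := Finset.mem_Icc.1 (hq (Finset.mem_image_of_mem _ hx))
  have h2 := Finset.mem_Icc.1 (subset_Icc hp hx)
  omega

theorem zero_notMem {A : SetPartition} {p : Finset ℕ} (hp : p ∈ A.parts) : 0 ∉ p := fun h => by
  have := Finset.mem_Icc.1 (subset_Icc hp h)
  omega

theorem nonempty_of_mem {A : SetPartition} {p : Finset ℕ} (hp : p ∈ A.parts) : p.Nonempty :=
  Finset.nonempty_iff_ne_empty.2 fun h => A.empty_notMem (h ▸ hp)

theorem mem_slash_right {A B : SetPartition} {p : Finset ℕ} (h0 : 0 ∉ p) :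
    p.image (· + A.size) ∈ (slash A B).parts ↔ p ∈ B.parts := by
  have hinj : Function.Injective (Finset.image (· + A.size)) :=
    Finset.image_injective (add_left_injective A.size)
  rw [parts_slash, Finset.mem_union, Finset.mem_image, or_iff_right]
  · constructor
    · rintro ⟨q, hq, h⟩
      exact hinj h ▸ hq
    · exact fun h => ⟨p, h, rfl⟩
  · intro h
    obtain ⟨x, hx⟩ := nonempty_of_mem h
    have h1 := Finset.mem_Icc.1 (subset_Icc h hx)
    obtain ⟨y, hy, rfl⟩ := Finset.mem_image.1 hx
    obtain rfl : y = 0 := by omega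
    exact h0 hy

theorem slash_left_cancel {A B B' : SetPartition} (h : slash A B = slash A B') : B = B' := by
  apply ext_parts
  ext p
  by_cases h0 : 0 ∈ p
  · exact iff_of_false (fun hp => zero_notMem hp h0) (fun hp => zero_notMem hp h0)
  · rw [← mem_slash_right (A := A) h0, h, mem_slash_right h0]

theorem slash_eq_slash {A B C D : SetPartition} (h : slash A B = slash C D)
    (hs : A.size ≤ C.size) : ∃ E : SetPartition, C = slash A E ∧ B = slash E D := by
  have hsz : A.size + B.size = C.size + D.size := congrArg size h
  -- a part of `C | D` with an element at most `|C|` is a part of `C`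
  have hC : ∀ q ∈ (slash C D).parts, ∀ x ∈ q, x ≤ C.size → q ∈ C.parts := by
    intro q hq x hx hxC
    rw [parts_slash, Finset.mem_union] at hq
    rcases hq with hq | hq
    · exact hq
    · obtain ⟨p, hp, rfl⟩ := Finset.mem_image.1 hq
      obtain ⟨y, hy, rfl⟩ := Finset.mem_image.1 hx
      have := Finset.mem_Icc.1 (subset_Icc hp hy)
      omega
  have hBC : ∀ p ∈ B.parts, ∀ x ∈ p, x + A.size ≤ C.size → p.image (· + A.size) ∈ C.parts :=
    fun p hp x hx hxC => hC _ (h ▸ (mem_slash_right (zero_notMem hp)).2 hp) _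
      (Finset.mem_image_of_mem _ hx) hxC
  let E : SetPartition := ofParts (C.size - A.size)
    (B.parts.filter (fun p => p ⊆ Finset.Icc 1 (C.size - A.size)))
    (fun h' => B.empty_notMem (Finset.mem_filter.1 h').1)
    (fun p hp q hq x hx hx' =>
      eq_of_mem (Finset.mem_filter.1 hp).1 (Finset.mem_filter.1 hq).1 hx hx')
    (by
      ext x
      simp only [Finset.mem_biUnion, Finset.mem_filter, id]
      constructor
      · rintro ⟨p, ⟨-, hp⟩, hx⟩
        exact hp hx
      · intro hx
        have hx' := Finset.mem_Icc.1 hx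
        obtain ⟨p, hp, hxp⟩ := (B.mem_cover (x := x)).2 ⟨by omega, by omega⟩
        refine ⟨p, ⟨hp, fun y hy => ?_⟩, hxp⟩
        have h1 := subset_Icc (hBC p hp x hxp (by omega)) (Finset.mem_image_of_mem _ hy)
        have h2 := Finset.mem_Icc.1 (subset_Icc hp hy)
        rw [Finset.mem_Icc] at h1 ⊢
        omega)
  have hE : C = slash A E := by
    apply ext_parts
    ext q
    rw [parts_slash, Finset.mem_union, Finset.mem_image]
    constructor
    · intro hq
      have hq' : q ∈ (slash A B).parts := by
        rw [h, parts_slash]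
        exact Finset.mem_union_left _ hq
      rw [parts_slash, Finset.mem_union, Finset.mem_image] at hq'
      rcases hq' with hq' | ⟨p, hp, rfl⟩
      · exact Or.inl hq'
      · refine Or.inr ⟨p, Finset.mem_filter.2 ⟨hp, fun y hy => ?_⟩, rfl⟩
        have h1 := Finset.mem_Icc.1 (subset_Icc hq (Finset.mem_image_of_mem _ hy))
        have h2 := Finset.mem_Icc.1 (subset_Icc hp hy)
        rw [Finset.mem_Icc]
        omega
    · rintro (hq | ⟨p, hp, rfl⟩)
      · obtain ⟨x, hx⟩ := nonempty_of_mem hq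
        have h1 := Finset.mem_Icc.1 (subset_Icc hq hx)
        refine hC q ?_ x hx (by omega)
        rw [← h, parts_slash]
        exact Finset.mem_union_left _ hq
      · obtain ⟨hp, hpE⟩ := Finset.mem_filter.1 hp
        obtain ⟨x, hx⟩ := nonempty_of_mem hp
        have h1 := Finset.mem_Icc.1 (hpE hx)
        exact hBC p hp x hx (by omega)
  refine ⟨E, hE, slash_left_cancel (A := A) ?_⟩
  rw [h, ← slash_assoc, ← hE]

theorem IsAtomic.eq_of_slash_eq {A B C D : SetPartition} (hA : A.IsAtomic) (hC : C.IsAtomic)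
    (h : slash A B = slash C D) : A = C := by
  wlog hs : A.size ≤ C.size generalizing A B C D
  · exact (this hC hA h.symm (by omega)).symm
  obtain ⟨E, hE, -⟩ := slash_eq_slash h hs
  by_cases h0 : E.size = 0
  · rw [hE, eq_empty h0, slash_empty]
  · exact absurd ⟨A, E, hA.1, h0, hE⟩ hC.2

theorem split_unique {L M : List SetPartition} (hL : ∀ a ∈ L, a.IsAtomic)
    (hM : ∀ a ∈ M, a.IsAtomic) (h : concat L = concat M) : L = M := by
  induction L generalizing M with
  | nil =>
    cases M with
    | nil => rfl
    | cons b M =>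
      have h1 : 0 = b.size + (concat M).size := congrArg size h
      exact absurd (by omega) (hM b (by simp)).1
  | cons a L ih =>
    cases M with
    | nil =>
      have h1 : a.size + (concat L).size = 0 := congrArg size h
      exact absurd (by omega) (hL a (by simp)).1
    | cons b M =>
      obtain rfl := IsAtomic.eq_of_slash_eq (hL a (by simp)) (hM b (by simp)) h
      rw [ih (fun x hx => hL x (by simp [hx])) (fun x hx => hM x (by simp [hx]))
        (slash_left_cancel h)]

/-- `A^!`, the list of atomic set partitions `(A⁽¹⁾, …, A⁽ᵈ⁾)` with `A = A⁽¹⁾ | ⋯ | A⁽ᵈ⁾`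
(it is unique by `split_unique`). -/
noncomputable def split (A : SetPartition) : List SetPartition := A.exists_split.choose

theorem isAtomic_of_mem_split {A a : SetPartition} (h : a ∈ A.split) : a.IsAtomic :=
  A.exists_split.choose_spec.1 a h

theorem concat_split (A : SetPartition) : concat A.split = A := A.exists_split.choose_spec.2

/-! ### The total order on set partitions and Lyndon set partitions -/

/-- The index `j` of the part `A_j` of `A` that contains `i ∈ [n]`, when the parts
`A_1, A_2, …` are listed in increasing order of their least elements: the number of parts whose
least element is at most the least element of the part of `i`. -/
def partIndex (A : SetPartition) (i : ℕ) : ℕ :=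
  (A.parts.filter (fun p => p.min ≤ (A.toFinpartition.part i).min)).card

/-- The word `w(A) = w_1 ⋯ w_n` with `w_i = j` if `i ∈ A_j`. -/
def word (A : SetPartition) : List ℕ := (List.range A.size).map (fun i => A.partIndex (i + 1))

/-- Comparing these keys lexicographically compares first the sizes, then the numbers of parts,
then the words. -/
def orderKey (A : SetPartition) : ℕ ×ₗ ℕ ×ₗ List ℕ :=
  toLex (A.size, toLex (A.length, A.word))

theorem partIndex_eq_iff {A : SetPartition} {i j : ℕ} (hi : i ∈ Finset.Icc 1 A.size)
    (hj : j ∈ Finset.Icc 1 A.size) :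
    A.partIndex i = A.partIndex j ↔ A.toFinpartition.part i = A.toFinpartition.part j := by
  refine ⟨fun h => ?_, fun h => by rw [partIndex, partIndex, h]⟩
  wlog hle : (A.toFinpartition.part i).min ≤ (A.toFinpartition.part j).min generalizing i j
  · exact (this hj hi h.symm (le_of_not_ge hle)).symm
  have hsub : A.parts.filter (fun p => p.min ≤ (A.toFinpartition.part i).min) ⊆
      A.parts.filter (fun p => p.min ≤ (A.toFinpartition.part j).min) :=
    Finset.monotone_filter_right _ fun p _ hp => le_trans hp hle
  have hpj := A.toFinpartition.part_mem.2 hj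
  have hmem : A.toFinpartition.part j ∈
      A.parts.filter (fun p => p.min ≤ (A.toFinpartition.part i).min) := by
    rw [Finset.eq_of_subset_of_card_le hsub h.ge]
    exact Finset.mem_filter.2 ⟨hpj, le_rfl⟩
  have hmin := le_antisymm hle (Finset.mem_filter.1 hmem).2
  obtain ⟨m, hm⟩ := Finset.min_of_mem (A.toFinpartition.mem_part_self.2 hi)
  exact eq_of_mem (A := A) (A.toFinpartition.part_mem.2 hi) hpj (Finset.mem_of_min hm)
    (Finset.mem_of_min (hmin ▸ hm))

theorem mem_parts_iff {A : SetPartition} {p : Finset ℕ} :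
    p ∈ A.parts ↔ ∃ i ∈ Finset.Icc 1 A.size,
      p = (Finset.Icc 1 A.size).filter (fun j => A.partIndex j = A.partIndex i) := by
  have key : ∀ i ∈ Finset.Icc 1 A.size, A.toFinpartition.part i =
      (Finset.Icc 1 A.size).filter (fun j => A.partIndex j = A.partIndex i) := by
    intro i hi
    ext j
    rw [Finset.mem_filter]
    constructor
    · intro h
      have hj := A.toFinpartition.part_subset i h
      exact ⟨hj, (partIndex_eq_iff hj hi).2
        ((A.toFinpartition.mem_part_iff_part_eq_part hj hi).1 h)⟩
    · rintro ⟨hj, h⟩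
      exact (A.toFinpartition.mem_part_iff_part_eq_part hj hi).2 ((partIndex_eq_iff hj hi).1 h)
  constructor
  · intro hp
    obtain ⟨i, hi⟩ := nonempty_of_mem hp
    refine ⟨i, subset_Icc hp hi, ?_⟩
    rw [← key i (subset_Icc hp hi)]
    exact (A.toFinpartition.part_eq_of_mem hp hi).symm
  · rintro ⟨i, hi, rfl⟩
    rw [← key i hi]
    exact A.toFinpartition.part_mem.2 hi

theorem orderKey_injective : Function.Injective orderKey := by
  intro A B h
  have h1 : (A.size, toLex (A.length, A.word)) = (B.size, toLex (B.length, B.word)) := h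
  have hs : A.size = B.size := (Prod.ext_iff.1 h1).1
  have h2 : (A.length, A.word) = (B.length, B.word) := (Prod.ext_iff.1 h1).2
  have hw : A.word = B.word := (Prod.ext_iff.1 h2).2
  rw [word, word, ← hs, List.map_inj_left] at hw
  have hi : ∀ i ∈ Finset.Icc 1 A.size, A.partIndex i = B.partIndex i := by
    intro i hi
    rw [Finset.mem_Icc] at hi
    have := hw (i - 1) (List.mem_range.2 (by omega))
    rwa [Nat.sub_add_cancel hi.1] at this
  apply ext_parts
  ext p
  rw [mem_parts_iff, mem_parts_iff, ← hs]
  refine exists_congr fun i => and_congr_right fun hi' => ?_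
  rw [hi i hi', Finset.filter_congr fun j hj => by rw [hi j hj]]

noncomputable instance : LinearOrder SetPartition :=
  LinearOrder.lift' orderKey orderKey_injective

theorem lt_iff {A B : SetPartition} : A < B ↔ A.size < B.size ∨ A.size = B.size ∧
    (A.length < B.length ∨ A.length = B.length ∧ A.word < B.word) := by
  change orderKey A < orderKey B ↔ _
  simp only [orderKey, Prod.Lex.toLex_lt_toLex]

/-- `A` is Lyndon if `A^!` is a Lyndon word in the alphabet of atomic set partitions. -/
def IsLyndon (A : SetPartition) : Prop := IsLyndonWord A.split

/-! ### Standardization and raising -/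

/-- The position (counted from `1`) of `x` in the finite set `S`. -/
def rank (S : Finset ℕ) (x : ℕ) : ℕ := (S.filter (· ≤ x)).card

theorem rank_lt_rank {S : Finset ℕ} {x y : ℕ} (hy : y ∈ S) (h : x < y) : rank S x < rank S y := by
  apply Finset.card_lt_card
  refine ⟨Finset.monotone_filter_right _ fun z _ (hz : z ≤ x) => hz.trans h.le, fun h' => ?_⟩
  have := (Finset.mem_filter.1 (h' (Finset.mem_filter.2 ⟨hy, le_rfl⟩))).2
  omega

theorem rank_le_rank_iff {S : Finset ℕ} {x y : ℕ} (hx : x ∈ S) :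
    rank S x ≤ rank S y ↔ x ≤ y := by
  constructor
  · intro h
    by_contra h'
    have := rank_lt_rank hx (not_le.1 h')
    omega
  · exact fun h => Finset.card_le_card
      (Finset.monotone_filter_right _ fun z _ (hz : z ≤ x) => hz.trans h)

theorem rank_injOn (S : Finset ℕ) : Set.InjOn (rank S) S := fun _ hx _ hy h =>
  le_antisymm ((rank_le_rank_iff hx).1 h.le) ((rank_le_rank_iff hy).1 h.ge)

theorem image_rank (S : Finset ℕ) : S.image (rank S) = Finset.Icc 1 S.card := by
  apply Finset.eq_of_subset_of_card_le
  · intro i hi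
    obtain ⟨x, hx, rfl⟩ := Finset.mem_image.1 hi
    rw [Finset.mem_Icc]
    exact ⟨Finset.card_pos.2 ⟨x, Finset.mem_filter.2 ⟨hx, le_rfl⟩⟩, Finset.card_filter_le _ _⟩
  · rw [Finset.card_image_of_injOn (rank_injOn S)]
    simp

theorem filter_rank_image {S p : Finset ℕ} (hp : p ⊆ S) :
    S.filter (fun x => rank S x ∈ p.image (rank S)) = p := by
  ext x
  rw [Finset.mem_filter, Finset.mem_image]
  constructor
  · rintro ⟨hx, y, hy, h⟩
    exact rank_injOn S (hp hy) hx h ▸ hy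
  · exact fun hx => ⟨hp hx, x, hx, rfl⟩

theorem image_rank_filter {S p : Finset ℕ} (hp : p ⊆ Finset.Icc 1 S.card) :
    (S.filter (fun x => rank S x ∈ p)).image (rank S) = p := by
  ext i
  rw [Finset.mem_image]
  constructor
  · rintro ⟨x, hx, rfl⟩
    exact (Finset.mem_filter.1 hx).2
  · intro hi
    have h := hp hi
    rw [← image_rank, Finset.mem_image] at h
    obtain ⟨x, hx, rfl⟩ := h
    exact ⟨x, Finset.mem_filter.2 ⟨hx, hi⟩, rfl⟩

theorem rank_image {S : Finset ℕ} {f : ℕ → ℕ} (hf : ∀ x ∈ S, ∀ y ∈ S, f x ≤ f y ↔ x ≤ y) {x : ℕ}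
    (hx : x ∈ S) : rank (S.image f) (f x) = rank S x := by
  have h : (S.image f).filter (· ≤ f x) = (S.filter (· ≤ x)).image f := by
    ext i
    simp only [Finset.mem_filter, Finset.mem_image]
    constructor
    · rintro ⟨⟨y, hy, rfl⟩, h⟩
      exact ⟨y, ⟨hy, (hf y hy x hx).1 h⟩, rfl⟩
    · rintro ⟨y, ⟨hy, h⟩, rfl⟩
      exact ⟨⟨y, hy, rfl⟩, (hf y hy x hx).2 h⟩
  rw [rank, h, rank, Finset.card_image_of_injOn]
  intro y hy z hz hyz
  have hy' := (Finset.mem_filter.1 hy).1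
  have hz' := (Finset.mem_filter.1 hz).1
  exact le_antisymm ((hf y hy' z hz').1 hyz.le) ((hf z hz' y hy').1 hyz.ge)

theorem subset_supp {T : Finset (Finset ℕ)} {p : Finset ℕ} (hp : p ∈ T) : p ⊆ T.biUnion id :=
  Finset.subset_biUnion_of_mem id hp

/-- `st(A_T)`: the set partition obtained from the parts of `A` that belong to `T` by lowering
the entries to `1, 2, …`, keeping their relative order. -/
def restrict (A : SetPartition) (T : Finset (Finset ℕ)) : SetPartition :=
  ofParts ((A.parts ∩ T).biUnion id).card
    ((A.parts ∩ T).image (Finset.image (rank ((A.parts ∩ T).biUnion id))))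
    (by
      simp only [Finset.mem_image, Finset.image_eq_empty, not_exists, not_and]
      rintro p hp rfl
      exact A.empty_notMem (Finset.mem_inter.1 hp).1)
    (by
      intro p hp q hq x hx hx'
      obtain ⟨r, hr, rfl⟩ := Finset.mem_image.1 hp
      obtain ⟨t, ht, rfl⟩ := Finset.mem_image.1 hq
      obtain ⟨y, hy, rfl⟩ := Finset.mem_image.1 hx
      obtain ⟨z, hz, h⟩ := Finset.mem_image.1 hx'
      obtain rfl := rank_injOn _ (subset_supp ht hz) (subset_supp hr hy) h
      rw [eq_of_mem (Finset.mem_inter.1 hr).1 (Finset.mem_inter.1 ht).1 hy hz])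
    (by
      rw [← image_rank]
      ext i
      simp only [Finset.mem_biUnion, Finset.mem_image, id]
      constructor
      · rintro ⟨_, ⟨p, hp, rfl⟩, h⟩
        obtain ⟨x, hx, rfl⟩ := Finset.mem_image.1 h
        exact ⟨x, ⟨p, hp, hx⟩, rfl⟩
      · rintro ⟨x, ⟨p, hp, hx⟩, rfl⟩
        exact ⟨_, ⟨p, hp, rfl⟩, Finset.mem_image_of_mem _ hx⟩)

theorem parts_restrict {A : SetPartition} {T : Finset (Finset ℕ)} (hT : T ⊆ A.parts) :
    (A.restrict T).parts = T.image (Finset.image (rank (T.biUnion id))) := by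
  rw [restrict, parts_ofParts, Finset.inter_eq_right.2 hT]

theorem size_restrict {A : SetPartition} {T : Finset (Finset ℕ)} (hT : T ⊆ A.parts) :
    (A.restrict T).size = (T.biUnion id).card := by
  rw [restrict, size_ofParts, Finset.inter_eq_right.2 hT]

theorem restrict_restrict {A : SetPartition} {T U : Finset (Finset ℕ)} (hU : U ⊆ A.parts)
    (hT : T ⊆ U) :
    (A.restrict U).restrict (T.image (Finset.image (rank (U.biUnion id)))) = A.restrict T := by
  apply ext_parts
  have h1 : T.image (Finset.image (rank (U.biUnion id))) ⊆ (A.restrict U).parts := by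
    rw [parts_restrict hU]
    exact Finset.image_subset_image hT
  have h2 : (T.image (Finset.image (rank (U.biUnion id)))).biUnion id =
      (T.biUnion id).image (rank (U.biUnion id)) := by
    rw [Finset.image_biUnion, Finset.biUnion_image]
    rfl
  have hTU : T.biUnion id ⊆ U.biUnion id := Finset.biUnion_subset_biUnion_of_subset_left _ hT
  rw [parts_restrict h1, parts_restrict (hT.trans hU), h2, Finset.image_image]
  refine Finset.image_congr fun p hp => ?_
  rw [Function.comp, Finset.image_image]
  refine Finset.image_congr fun x hx => ?_
  exact rank_image (fun y hy z _ => rank_le_rank_iff (hTU hy)) (subset_supp hp hx)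

/-- `A ↑_S`: the family of sets obtained by raising the entries of `A` to the elements of `S`,
keeping their relative order (`S` has `|A|` elements). -/
def raise (S : Finset ℕ) (A : SetPartition) : Finset (Finset ℕ) :=
  A.parts.image (fun p => S.filter (fun x => rank S x ∈ p))

theorem image_rank_raise {S : Finset ℕ} {A : SetPartition} (hS : S.card = A.size) :
    (raise S A).image (Finset.image (rank S)) = A.parts := by
  rw [raise, Finset.image_image]
  conv_rhs => rw [← Finset.image_id (s := A.parts)]
  exact Finset.image_congr fun p hp => image_rank_filter (hS ▸ subset_Icc hp)

theorem raise_restrict {A : SetPartition} {T : Finset (Finset ℕ)} (hT : T ⊆ A.parts) :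
    raise (T.biUnion id) (A.restrict T) = T := by
  rw [raise, parts_restrict hT, Finset.image_image]
  conv_rhs => rw [← Finset.image_id (s := T)]
  exact Finset.image_congr fun p hp => filter_rank_image (subset_supp hp)

theorem empty_notMem_raise {S : Finset ℕ} {A : SetPartition} (hS : S.card = A.size) :
    ∅ ∉ raise S A := fun h => by
  have := Finset.mem_image_of_mem (Finset.image (rank S)) h
  rw [image_rank_raise hS, Finset.image_empty] at this
  exact A.empty_notMem this

theorem raise_disjoint {S : Finset ℕ} {A : SetPartition} {p q : Finset ℕ} {x : ℕ}
    (hp : p ∈ raise S A) (hq : q ∈ raise S A) (hx : x ∈ p) (hx' : x ∈ q) : p = q := by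
  obtain ⟨r, hr, rfl⟩ := Finset.mem_image.1 hp
  obtain ⟨t, ht, rfl⟩ := Finset.mem_image.1 hq
  rw [eq_of_mem hr ht (Finset.mem_filter.1 hx).2 (Finset.mem_filter.1 hx').2]

theorem subset_of_mem_raise {S : Finset ℕ} {A : SetPartition} {p : Finset ℕ}
    (hp : p ∈ raise S A) : p ⊆ S := by
  obtain ⟨p, -, rfl⟩ := Finset.mem_image.1 hp
  exact Finset.filter_subset _ _

theorem biUnion_raise {S : Finset ℕ} {A : SetPartition} (hS : S.card = A.size) :
    (raise S A).biUnion id = S := by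
  ext x
  constructor
  · intro h
    obtain ⟨p, hp, hx⟩ := Finset.mem_biUnion.1 h
    exact subset_of_mem_raise hp hx
  · intro hx
    have h1 := Finset.mem_image_of_mem (rank S) hx
    rw [image_rank, hS, ← biUnion_parts, Finset.mem_biUnion] at h1
    obtain ⟨p, hp, hxp⟩ := h1
    exact Finset.mem_biUnion.2
      ⟨_, Finset.mem_image_of_mem _ hp, Finset.mem_filter.2 ⟨hx, hxp⟩⟩

theorem card_compl {n m : ℕ} {S : Finset ℕ}
    (hS : S ∈ (Finset.Icc 1 (n + m)).powersetCard n) : (Finset.Icc 1 (n + m) \ S).card = m := by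
  rw [Finset.mem_powersetCard] at hS
  rw [Finset.card_sdiff_of_subset hS.1, hS.2]
  simp

/-- `A ↑_S ∪ B ↑_{[n+m] ∖ S}` for `A ⊢ [n]`, `B ⊢ [m]` and an `n`-element subset `S` of
`[n+m]`. -/
def merge (A B : SetPartition) (S : Finset ℕ)
    (hS : S ∈ (Finset.Icc 1 (A.size + B.size)).powersetCard A.size) : SetPartition :=
  ofParts (A.size + B.size) (raise S A ∪ raise (Finset.Icc 1 (A.size + B.size) \ S) B)
    (by
      rw [Finset.mem_union, not_or]
      exact ⟨empty_notMem_raise (Finset.mem_powersetCard.1 hS).2,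
        empty_notMem_raise (card_compl hS)⟩)
    (by
      intro p hp q hq x hx hx'
      rcases Finset.mem_union.1 hp with hp | hp <;> rcases Finset.mem_union.1 hq with hq | hq
      · exact raise_disjoint hp hq hx hx'
      · exact absurd (subset_of_mem_raise hp hx)
          (Finset.mem_sdiff.1 (subset_of_mem_raise hq hx')).2
      · exact absurd (subset_of_mem_raise hq hx')
          (Finset.mem_sdiff.1 (subset_of_mem_raise hp hx)).2
      · exact raise_disjoint hp hq hx hx')
    (by
      rw [Finset.union_biUnion, biUnion_raise (Finset.mem_powersetCard.1 hS).2,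
        biUnion_raise (card_compl hS),
        Finset.union_sdiff_of_subset (Finset.mem_powersetCard.1 hS).1])

theorem parts_merge (A B S hS) : (merge A B S hS).parts =
    raise S A ∪ raise (Finset.Icc 1 (A.size + B.size) \ S) B := rfl

theorem merge_parts_sdiff (A B S hS) : (merge A B S hS).parts \ raise S A =
    raise (Finset.Icc 1 (A.size + B.size) \ S) B := by
  rw [parts_merge, Finset.union_sdiff_cancel_left]
  rw [Finset.disjoint_left]
  intro p hp hq
  obtain ⟨x, hx⟩ := Finset.nonempty_iff_ne_empty.2
    (fun h => empty_notMem_raise (Finset.mem_powersetCard.1 hS).2 (h ▸ hp))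
  exact (Finset.mem_sdiff.1 (subset_of_mem_raise hq hx)).2 (subset_of_mem_raise hp hx)

theorem restrict_merge_left (A B S hS) : (merge A B S hS).restrict (raise S A) = A := by
  have h := (Finset.mem_powersetCard.1 hS).2
  apply ext_parts
  rw [parts_restrict (by rw [parts_merge]; exact Finset.subset_union_left), biUnion_raise h,
    image_rank_raise h]

theorem restrict_merge_right (A B S hS) :
    (merge A B S hS).restrict ((merge A B S hS).parts \ raise S A) = B := by
  have h := card_compl hS
  apply ext_parts
  rw [merge_parts_sdiff, parts_restrict (by rw [parts_merge]; exact Finset.subset_union_right),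
    biUnion_raise h, image_rank_raise h]

theorem supp_sdiff {C : SetPartition} {T : Finset (Finset ℕ)} (hT : T ⊆ C.parts) :
    (C.parts \ T).biUnion id = Finset.Icc 1 C.size \ T.biUnion id := by
  ext x
  rw [Finset.mem_sdiff, ← biUnion_parts]
  simp only [Finset.mem_biUnion, Finset.mem_sdiff, id, not_exists, not_and]
  constructor
  · rintro ⟨p, ⟨hp, hpT⟩, hx⟩
    exact ⟨⟨p, hp, hx⟩, fun q hq hxq => hpT (eq_of_mem (hT hq) hp hxq hx ▸ hq)⟩
  · rintro ⟨⟨p, hp, hx⟩, h⟩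
    exact ⟨p, ⟨hp, fun h' => h p h' hx⟩, hx⟩

theorem size_restrict_add {C : SetPartition} {T : Finset (Finset ℕ)} (hT : T ⊆ C.parts) :
    (C.restrict T).size + (C.restrict (C.parts \ T)).size = C.size := by
  have hsub : T.biUnion id ⊆ Finset.Icc 1 C.size := by
    rw [← biUnion_parts]
    exact Finset.biUnion_subset_biUnion_of_subset_left _ hT
  rw [size_restrict hT, size_restrict Finset.sdiff_subset, supp_sdiff hT, add_comm,
    Finset.card_sdiff_add_card_eq_card hsub]
  simp

theorem supp_mem {C : SetPartition} {T : Finset (Finset ℕ)} (hT : T ⊆ C.parts) :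
    T.biUnion id ∈ (Finset.Icc 1 ((C.restrict T).size + (C.restrict (C.parts \ T)).size)).powersetCard
      (C.restrict T).size := by
  rw [Finset.mem_powersetCard, size_restrict_add hT, size_restrict hT, ← biUnion_parts]
  exact ⟨Finset.biUnion_subset_biUnion_of_subset_left _ hT, rfl⟩

theorem merge_restrict {C : SetPartition} {T : Finset (Finset ℕ)} (hT : T ⊆ C.parts) :
    merge (C.restrict T) (C.restrict (C.parts \ T)) (T.biUnion id) (supp_mem hT) = C := by
  apply ext_parts
  rw [parts_merge, raise_restrict hT, size_restrict_add hT, ← supp_sdiff hT,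
    raise_restrict Finset.sdiff_subset, Finset.union_sdiff_of_subset hT]

theorem card_merge_eq (A B C : SetPartition) :
    (((Finset.Icc 1 (A.size + B.size)).powersetCard A.size).attach.filter
      (fun S => merge A B S.1 S.2 = C)).card =
    (C.parts.powerset.filter
      (fun T => C.restrict T = A ∧ C.restrict (C.parts \ T) = B)).card := by
  refine Finset.card_bij (fun S _ => raise S.1 A) ?_ ?_ ?_
  · rintro ⟨S, hS⟩ h
    obtain rfl := (Finset.mem_filter.1 h).2
    rw [Finset.mem_filter, Finset.mem_powerset]
    refine ⟨?_, restrict_merge_left A B S hS, restrict_merge_right A B S hS⟩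
    rw [parts_merge]
    exact Finset.subset_union_left
  · rintro ⟨S, hS⟩ - ⟨S', hS'⟩ - h
    apply Subtype.ext
    have h' := congrArg (fun T : Finset (Finset ℕ) => T.biUnion id) h
    simpa only [biUnion_raise (Finset.mem_powersetCard.1 hS).2,
      biUnion_raise (Finset.mem_powersetCard.1 hS').2] using h'
  · intro T h
    obtain ⟨hT, rfl, rfl⟩ := Finset.mem_filter.1 h
    rw [Finset.mem_powerset] at hT
    exact ⟨⟨_, supp_mem hT⟩, Finset.mem_filter.2 ⟨Finset.mem_attach _ _, merge_restrict hT⟩,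
      raise_restrict hT⟩

end SetPartition

/-! ### The algebra `NCSym*` -/

/-- The graded dual of `NCSym`: the free `K`-module on the elements `w_A`, for all set
partitions `A`. -/
def NCSymDual (K : Type*) [CommRing K] : Type _ := SetPartition →₀ K

namespace NCSymDual

open SetPartition

variable {K : Type*} [CommRing K]

noncomputable instance : AddCommGroup (NCSymDual K) :=
  inferInstanceAs (AddCommGroup (SetPartition →₀ K))

noncomputable instance : Module K (NCSymDual K) :=
  inferInstanceAs (Module K (SetPartition →₀ K))

/-- The basis of the `w_A`. -/
noncomputable def basis (K : Type*) [CommRing K] : Module.Basis SetPartition K (NCSymDual K) :=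
  Module.Basis.ofRepr (LinearEquiv.refl K (SetPartition →₀ K))

/-- The basis element `w_A`. -/
noncomputable def w (K : Type*) [CommRing K] (A : SetPartition) : NCSymDual K := basis K A

/-- The coefficient of `w_C` in `x`. -/
noncomputable def coeff (x : NCSymDual K) (C : SetPartition) : K := (basis K).repr x C

theorem coeff_w (A C : SetPartition) : coeff (w K A) C = if A = C then 1 else 0 := by
  classical
  rw [coeff, w, Module.Basis.repr_self, Finsupp.single_apply]

theorem ext_coeff {x y : NCSymDual K} (h : ∀ C, coeff x C = coeff y C) : x = y :=
  (basis K).repr.injective (Finsupp.ext h)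

/-- The product of `NCSym*` as a bilinear map, given on the basis by
`w_A w_B = ∑_S w_{A ↑_S ∪ B ↑_{[n+m] ∖ S}}`, where `A ⊢ [n]`, `B ⊢ [m]` and `S` runs over the
`n`-element subsets of `[n+m]`. -/
noncomputable def mulHom (K : Type*) [CommRing K] :
    NCSymDual K →ₗ[K] NCSymDual K →ₗ[K] NCSymDual K :=
  (basis K).constr K fun A => (basis K).constr K fun B =>
    ∑ S ∈ ((Finset.Icc 1 (A.size + B.size)).powersetCard A.size).attach, w K (merge A B S.1 S.2)

noncomputable instance : Mul (NCSymDual K) := ⟨fun x y => mulHom K x y⟩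

noncomputable instance : One (NCSymDual K) := ⟨w K SetPartition.empty⟩

theorem mul_def (x y : NCSymDual K) : x * y = mulHom K x y := rfl

theorem one_def : (1 : NCSymDual K) = w K SetPartition.empty := rfl

/-- The product of two basis elements. -/
theorem w_mul_w (A B : SetPartition) : w K A * w K B =
    ∑ S ∈ ((Finset.Icc 1 (A.size + B.size)).powersetCard A.size).attach,
      w K (merge A B S.1 S.2) := by
  rw [mul_def, mulHom, w, w, Module.Basis.constr_basis, Module.Basis.constr_basis]

/-- `coeff` as a linear form. -/
noncomputable def coeffHom (C : SetPartition) : NCSymDual K →ₗ[K] K := (basis K).coord C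

theorem coeffHom_apply (C : SetPartition) (x : NCSymDual K) : coeffHom C x = coeff x C := rfl

theorem coeff_mul (x y : NCSymDual K) (C : SetPartition) : coeff (x * y) C =
    ∑ T ∈ C.parts.powerset, coeff x (C.restrict T) * coeff y (C.restrict (C.parts \ T)) := by
  have h : (mulHom K).compr₂ (coeffHom C) = ∑ T ∈ C.parts.powerset,
      ((LinearMap.mul K K).compl₁₂ (coeffHom (C.restrict T))
        (coeffHom (C.restrict (C.parts \ T)))) := by
    refine (basis K).ext fun A => (basis K).ext fun B => ?_
    have h1 : (mulHom K).compr₂ (coeffHom C) (basis K A) (basis K B) =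
        coeffHom C (w K A * w K B) := rfl
    rw [h1, w_mul_w, map_sum]
    simp only [coeffHom_apply, coeff_w, Finset.sum_boole, card_merge_eq, LinearMap.sum_apply,
      LinearMap.compl₁₂_apply, LinearMap.mul_apply']
    rw [← Finset.sum_boole]
    refine Finset.sum_congr rfl fun T _ => ?_
    change _ = coeff (w K A) _ * coeff (w K B) _
    rw [coeff_w, coeff_w, ite_zero_mul_ite_zero, one_mul]
    simp only [eq_comm]
  have h2 := LinearMap.congr_fun₂ h x y
  simp only [LinearMap.sum_apply, LinearMap.compr₂_apply, LinearMap.compl₁₂_apply,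
    LinearMap.mul_apply', coeffHom_apply] at h2
  exact h2

theorem coeff_add (x y : NCSymDual K) (C) : coeff (x + y) C = coeff x C + coeff y C :=
  map_add (coeffHom C) x y

theorem coeff_one (C : SetPartition) :
    coeff (1 : NCSymDual K) C = if C.parts = ∅ then 1 else 0 := by
  rw [one_def, coeff_w]
  exact if_congr ⟨fun h => h ▸ rfl, fun h => ext_parts h.symm⟩ rfl rfl

theorem restrict_self (C : SetPartition) : C.restrict C.parts = C := by
  apply ext_parts
  rw [parts_restrict subset_rfl]
  conv_rhs => rw [← Finset.image_id (s := C.parts)]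
  refine Finset.image_congr fun p hp => ?_
  conv_rhs => rw [id, ← Finset.image_id (s := p)]
  refine Finset.image_congr fun x hx => ?_
  have hx' := Finset.mem_Icc.1 (subset_Icc hp hx)
  have : (Finset.Icc 1 C.size).filter (· ≤ x) = Finset.Icc 1 x := by
    ext y
    simp only [Finset.mem_filter, Finset.mem_Icc]
    omega
  rw [rank, biUnion_parts, this]
  simp

protected theorem mul_comm' (x y : NCSymDual K) : x * y = y * x := by
  refine ext_coeff fun C => ?_
  rw [coeff_mul, coeff_mul]
  refine Finset.sum_nbij' (fun T => C.parts \ T) (fun T => C.parts \ T) ?_ ?_ ?_ ?_ ?_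
  · intro T _
    exact Finset.mem_powerset.2 Finset.sdiff_subset
  · intro T _
    exact Finset.mem_powerset.2 Finset.sdiff_subset
  · intro T hT
    exact Finset.sdiff_sdiff_eq_self (Finset.mem_powerset.1 hT)
  · intro T hT
    exact Finset.sdiff_sdiff_eq_self (Finset.mem_powerset.1 hT)
  · intro T hT
    rw [Finset.sdiff_sdiff_eq_self (Finset.mem_powerset.1 hT), mul_comm]

protected theorem one_mul' (x : NCSymDual K) : 1 * x = x := by
  refine ext_coeff fun C => ?_
  rw [coeff_mul, Finset.sum_eq_single ∅]
  · rw [Finset.sdiff_empty, restrict_self, coeff_one,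
      if_pos (by rw [parts_restrict (by simp)]; simp), one_mul]
  · intro T hT hne
    rw [coeff_one, if_neg, zero_mul]
    rw [parts_restrict (Finset.mem_powerset.1 hT)]
    simpa using hne
  · simp

/-- Sub-families of the parts of `st(C_U)` correspond to sub-families of `U`. -/
theorem sum_powerset_restrict {M : Type*} [AddCommMonoid M] {C : SetPartition}
    {U : Finset (Finset ℕ)} (hU : U ⊆ C.parts) (F : SetPartition → SetPartition → M) :
    ∑ T ∈ (C.restrict U).parts.powerset,
      F ((C.restrict U).restrict T) ((C.restrict U).restrict ((C.restrict U).parts \ T)) =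
    ∑ T ∈ U.powerset, F (C.restrict T) (C.restrict (U \ T)) := by
  have hinj : Set.InjOn (Finset.image (rank (U.biUnion id))) U := by
    intro p hp q hq h
    rw [← filter_rank_image (subset_supp hp), h, filter_rank_image (subset_supp hq)]
  symm
  refine Finset.sum_bij (fun T _ => T.image (Finset.image (rank (U.biUnion id)))) ?_ ?_ ?_ ?_
  · intro T hT
    rw [Finset.mem_powerset] at hT ⊢
    rw [parts_restrict hU]
    exact Finset.image_subset_image hT
  · intro T hT T' hT' h
    exact Finset.image_injOn_powerset_of_injOn hinj hT hT' h
  · intro T hT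
    rw [Finset.mem_powerset, parts_restrict hU] at hT
    obtain ⟨T', hT', rfl⟩ := Finset.subset_image_iff.1 hT
    exact ⟨T', Finset.mem_powerset.2 hT', rfl⟩
  · intro T hT
    rw [Finset.mem_powerset] at hT
    rw [parts_restrict hU, ← Finset.image_sdiff_of_injOn hinj hT, restrict_restrict hU hT,
      restrict_restrict hU Finset.sdiff_subset]

protected theorem mul_assoc' (x y z : NCSymDual K) : x * y * z = x * (y * z) := by
  refine ext_coeff fun C => ?_
  rw [coeff_mul, coeff_mul]
  have h1 : ∀ U ∈ C.parts.powerset,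
      coeff (x * y) (C.restrict U) * coeff z (C.restrict (C.parts \ U)) =
      ∑ T ∈ U.powerset, coeff x (C.restrict T) * coeff y (C.restrict (U \ T)) *
        coeff z (C.restrict (C.parts \ U)) := by
    intro U hU
    rw [coeff_mul, sum_powerset_restrict (Finset.mem_powerset.1 hU)
      (fun A B => coeff x A * coeff y B), Finset.sum_mul]
  have h2 : ∀ V ∈ C.parts.powerset,
      coeff x (C.restrict V) * coeff (y * z) (C.restrict (C.parts \ V)) =
      ∑ T ∈ (C.parts \ V).powerset, coeff x (C.restrict V) *
        (coeff y (C.restrict T) * coeff z (C.restrict ((C.parts \ V) \ T))) := by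
    intro V _
    rw [coeff_mul, sum_powerset_restrict Finset.sdiff_subset
      (fun A B => coeff y A * coeff z B), Finset.mul_sum]
  rw [Finset.sum_congr rfl h1, Finset.sum_congr rfl h2, Finset.sum_sigma', Finset.sum_sigma']
  refine Finset.sum_nbij' (fun a => ⟨a.2, a.1 \ a.2⟩) (fun a => ⟨a.1 ∪ a.2, a.1⟩) ?_ ?_ ?_ ?_ ?_
  · rintro ⟨U, T⟩ h
    simp only [Finset.mem_sigma, Finset.mem_powerset] at h ⊢
    exact ⟨h.2.trans h.1, Finset.sdiff_subset_sdiff h.1 subset_rfl⟩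
  · rintro ⟨V, T⟩ h
    simp only [Finset.mem_sigma, Finset.mem_powerset] at h ⊢
    exact ⟨Finset.union_subset h.1 (h.2.trans Finset.sdiff_subset), Finset.subset_union_left⟩
  · rintro ⟨U, T⟩ h
    simp only [Finset.mem_sigma, Finset.mem_powerset] at h
    simp only [Finset.union_sdiff_of_subset h.2]
  · rintro ⟨V, T⟩ h
    simp only [Finset.mem_sigma, Finset.mem_powerset] at h
    have : Disjoint V T := (Finset.disjoint_of_subset_left h.2 Finset.sdiff_disjoint).symm
    simp only [Finset.union_sdiff_cancel_left this]
  · rintro ⟨U, T⟩ h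
    simp only [Finset.mem_sigma, Finset.mem_powerset] at h
    have : (C.parts \ T) \ (U \ T) = C.parts \ U := by
      rw [sdiff_sdiff_left, Finset.sup_eq_union, Finset.union_sdiff_of_subset h.2]
    simp only [this, mul_assoc]

noncomputable instance : CommRing (NCSymDual K) :=
  { (inferInstance : AddCommGroup (NCSymDual K)),
    (inferInstance : Mul (NCSymDual K)),
    (inferInstance : One (NCSymDual K)) with
    left_distrib := fun x y z => map_add (mulHom K x) y z
    right_distrib := fun x y z => by simp only [mul_def, map_add, LinearMap.add_apply]
    zero_mul := fun x => by simp only [mul_def, map_zero, LinearMap.zero_apply]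
    mul_zero := fun x => map_zero (mulHom K x)
    mul_assoc := NCSymDual.mul_assoc'
    one_mul := NCSymDual.one_mul'
    mul_one := fun x => by rw [NCSymDual.mul_comm', NCSymDual.one_mul']
    mul_comm := NCSymDual.mul_comm' }

noncomputable instance : Algebra K (NCSymDual K) :=
  Algebra.ofModule (fun r x y => by simp only [mul_def, map_smul, LinearMap.smul_apply])
    (fun r x y => by simp only [mul_def, map_smul])

end NCSymDual

/-! ### The coalgebra `NCSym` and the duality -/

/-- `NCSym`: the free `K`-module on the elements `m_A`, for all set partitions `A`. -/
def NCSym (K : Type*) [CommRing K] : Type _ := SetPartition →₀ K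

namespace NCSym

open SetPartition
open scoped TensorProduct

variable {K : Type*} [CommRing K]

noncomputable instance : AddCommGroup (NCSym K) :=
  inferInstanceAs (AddCommGroup (SetPartition →₀ K))

noncomputable instance : Module K (NCSym K) :=
  inferInstanceAs (Module K (SetPartition →₀ K))

/-- The basis of the `m_A`. -/
noncomputable def basis (K : Type*) [CommRing K] : Module.Basis SetPartition K (NCSym K) :=
  Module.Basis.ofRepr (LinearEquiv.refl K (SetPartition →₀ K))

/-- The basis element `m_A`. -/
noncomputable def m (K : Type*) [CommRing K] (A : SetPartition) : NCSym K := basis K A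

/-- The coproduct `Δ(m_A) = ∑_T m_{st(A_T)} ⊗ m_{st(A_{Tᶜ})}`, over all sets `T` of parts of
`A`. -/
noncomputable def coproduct (K : Type*) [CommRing K] : NCSym K →ₗ[K] NCSym K ⊗[K] NCSym K :=
  (basis K).constr K fun A =>
    ∑ T ∈ A.parts.powerset, m K (A.restrict T) ⊗ₜ[K] m K (A.restrict (A.parts \ T))

/-- The pairing with `[m_A, w_B] = δ_{AB}`. -/
noncomputable def pairing (K : Type*) [CommRing K] : NCSym K →ₗ[K] NCSymDual K →ₗ[K] K :=
  (basis K).constr K fun A => (NCSymDual.basis K).coord A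

/-- The product of `NCSym*` is dual to the coproduct of `NCSym`:
`[f, x y] = [Δ f, x ⊗ y]`. -/
theorem pairing_mul (f : NCSym K) (x y : NCSymDual K) :
    pairing K f (x * y) = TensorProduct.lid K K
      (TensorProduct.map ((pairing K).flip x) ((pairing K).flip y) (coproduct K f)) := by
  have hp : ∀ (A : SetPartition) (z : NCSymDual K),
      pairing K (m K A) z = NCSymDual.coeff z A := by
    intro A z
    rw [pairing, m, Module.Basis.constr_basis]
    rfl
  have h : (pairing K).flip (x * y) = (TensorProduct.lid K K).toLinearMap ∘ₗ
      TensorProduct.map ((pairing K).flip x) ((pairing K).flip y) ∘ₗ coproduct K := by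
    refine (basis K).ext fun C => ?_
    change pairing K (m K C) (x * y) = TensorProduct.lid K K
      (TensorProduct.map ((pairing K).flip x) ((pairing K).flip y) (coproduct K (basis K C)))
    rw [hp, NCSymDual.coeff_mul, coproduct, Module.Basis.constr_basis, map_sum, map_sum]
    refine Finset.sum_congr rfl fun T _ => ?_
    rw [TensorProduct.map_tmul, TensorProduct.lid_tmul, LinearMap.flip_apply,
      LinearMap.flip_apply, hp, hp, smul_eq_mul]
  exact LinearMap.congr_fun h f

end NCSym

/-! The argument is Radford's theorem on shuffle algebras, transferred to `NCSym*` by a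
triangularity argument. By `coeff_mul`, the coefficient of `w_C` in `w_A w_B` counts the ways to
divide the parts of `C` into two families that standardize to `A` and `B`. If no atom of `C` is cut
by the division, the word of atoms of `C` is a shuffle of those of `A` and `B`; if one is cut, `C`
has fewer atoms than `A` and `B` together (`isShuffle_split_restrict`). Hence, for the order
`AtomLT` (number of atoms, then the word of atoms), the leading term of a product is governed by the
largest shuffle.

If a word `l` is at most every nonempty suffix of `x`, the largest shuffle of `x` and `l` is `x ++
l` (`IsShuffle.le_append`). This applies when `x` is a nonincreasing product of Lyndon words and `l`
is a Lyndon word not exceeding any of them. So a monomial in the generators, with factors in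
nonincreasing order `A₁ ≥ ⋯ ≥ Aₖ`, has leading term `A₁ | ⋯ | Aₖ` (`hasLeading_prod`); its
coefficient is a positive integer, nonzero in characteristic `0`.

Every word is uniquely a nonincreasing product of Lyndon words (Chen–Fox–Lyndon), so each set
partition is the leading term of exactly one monomial. Distinct leading terms give linear
independence of the monomials, that is, algebraic independence of the generators; as `AtomLT` is
well-founded, the monomials also span. -/

/-! ### Shuffles of words -/

/-- `IsShuffle u v w`: the word `w` is a shuffle of the words `u` and `v`. -/
inductive IsShuffle {α : Type*} : List α → List α → List α → Prop
  | nil : IsShuffle [] [] []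
  | left (a : α) {u v w : List α} : IsShuffle u v w → IsShuffle (a :: u) v (a :: w)
  | right (a : α) {u v w : List α} : IsShuffle u v w → IsShuffle u (a :: v) (a :: w)

namespace IsShuffle

variable {α : Type*}

theorem length_eq {u v w : List α} (h : IsShuffle u v w) : w.length = u.length + v.length := by
  induction h with
  | nil => rfl
  | left a _ ih => simp only [List.length_cons]; omega
  | right a _ ih => simp only [List.length_cons]; omega

theorem nil_left (v : List α) : IsShuffle [] v v := by
  induction v with
  | nil => exact nil
  | cons a v ih => exact right a ih

theorem eq_of_nil_left {v w : List α} (h : IsShuffle [] v w) : w = v := by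
  induction v generalizing w with
  | nil => cases h; rfl
  | cons a v ih => cases h with | right _ h => rw [ih h]

theorem append (u v : List α) : IsShuffle u v (u ++ v) := by
  induction u with
  | nil => exact nil_left v
  | cons a u ih => exact left a ih

variable [LinearOrder α]

/-- Shuffling, at the same positions, with a larger word of the same length gives a larger word. -/
theorem exists_gt {u u' v w : List α} (h : IsShuffle u v w) (hl : u.length = u'.length)
    (hu : u < u') : ∃ w', IsShuffle u' v w' ∧ w < w' := by
  induction h generalizing u' with
  | nil =>
    obtain rfl : u' = [] := List.eq_nil_of_length_eq_zero hl.symm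
    exact absurd hu (lt_irrefl _)
  | right a _ ih =>
    obtain ⟨w', h1, h2⟩ := ih hl hu
    exact ⟨a :: w', right a h1, List.cons_lt_cons_iff.2 (Or.inr ⟨rfl, h2⟩)⟩
  | @left a u v w h ih =>
    cases u' with
    | nil => simp at hl
    | cons b u' =>
      have hl' : u.length = u'.length := by simpa using hl
      rcases List.cons_lt_cons_iff.1 hu with hab | ⟨rfl, hu'⟩
      -- Once the first letters differ the comparison is decided, so any shuffle of the tails will
      -- do.
      · exact ⟨b :: (u' ++ v), left b (append u' v), List.cons_lt_cons_iff.2 (Or.inl hab)⟩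
      · obtain ⟨w', h1, h2⟩ := ih hl' hu'
        exact ⟨a :: w', left a h1, List.cons_lt_cons_iff.2 (Or.inr ⟨rfl, h2⟩)⟩

/-- If `t ≤ s`, then moving a prefix `q` from `s` to `t` does not decrease the largest shuffle. -/
theorem exists_ge_of_swap {q s t w : List α} (hts : t ≤ s) (h : IsShuffle (q ++ s) t w) :
    ∃ w', IsShuffle s (q ++ t) w' ∧ w ≤ w' := by
  induction w generalizing q s t with
  | nil =>
    have := h.length_eq
    simp only [List.length_nil, List.length_append] at this
    obtain rfl : q = [] := List.eq_nil_of_length_eq_zero (by omega)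
    exact ⟨[], h, le_rfl⟩
  | cons d w ih =>
    generalize hq : q ++ s = x at h
    cases h with
    | @left _ u _ _ h =>
      cases q with
      | nil =>
        obtain rfl : s = d :: u := hq
        exact ⟨d :: w, left d h, le_rfl⟩
      -- The first letter of `q` keeps its place in the shuffle but is now read from the second
      -- word.
      | cons e q =>
        obtain ⟨rfl, rfl⟩ : e = d ∧ q ++ s = u := by simpa using hq
        obtain ⟨w', h1, h2⟩ := ih hts h
        exact ⟨e :: w', right e h1, List.cons_le_cons e h2⟩
    | @right _ _ t _ h =>
      subst hq
      cases s with
      | nil => exact absurd (List.nil_lt_cons d t) hts.not_gt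
      | cons e s =>
        rcases lt_or_ge d e with hde | hde
        -- Starting with `e > d` already wins.
        · exact ⟨_, append (e :: s) _, (List.cons_lt_cons_iff.2 (Or.inl hde)).le⟩
        · have hts' : d = e ∧ t ≤ s := by
            rcases hts.lt_or_eq with hlt | heq
            · rcases List.cons_lt_cons_iff.1 hlt with h' | ⟨h', h''⟩
              · exact absurd h' (not_lt.2 hde)
              · exact ⟨h', h''.le⟩
            · rw [List.cons.injEq] at heq
              exact ⟨heq.1, heq.2.le⟩
          obtain ⟨rfl, hts'⟩ := hts'
          -- With equal first letters, `d` is read from `s` instead of `t`. The prefix to be moved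
          -- grows to `q ++ [d]`, and its last letter takes the place of the `d` of `t`.
          rw [List.append_cons q] at h
          obtain ⟨w', h1, h2⟩ := ih hts' h
          refine ⟨d :: w', left d ?_, List.cons_le_cons d h2⟩
          simpa using h1

/-- If all nonempty suffixes of `x` are at least `l`, then `x ++ l` is the largest shuffle of `x`
and `l`. -/
theorem le_append {x l w : List α} (hx : ∀ s, s <:+ x → s ≠ [] → l ≤ s)
    (h : IsShuffle x l w) : w ≤ x ++ l := by
  induction x generalizing w with
  | nil => exact h.eq_of_nil_left.le
  | cons c x ih =>
    have hx' : ∀ s, s <:+ x → s ≠ [] → l ≤ s :=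
      fun s hs => hx s (hs.trans (List.suffix_cons c x))
    have hxl := hx _ List.suffix_rfl (List.cons_ne_nil c x)
    cases h with
    | left _ h => exact List.cons_le_cons c (ih hx' h)
    | @right d _ l w h =>
      rcases hxl.lt_or_eq with hlt | heq
      · rcases List.cons_lt_cons_iff.1 hlt with h' | ⟨rfl, h''⟩
        · exact (List.cons_lt_cons_iff.2 (Or.inl h')).le
        -- With equal first letters, the `d` taken from the second word is treated as that of `x`.
        -- Moving the remaining `[d]` across restores the full second word against the tail of `x`,
        -- where induction applies.
        · obtain ⟨w', h1, h2⟩ := exists_ge_of_swap (q := [d]) h''.le h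
          exact List.cons_le_cons d (h2.trans (ih hx' h1))
      · rw [List.cons.injEq] at heq
        obtain ⟨rfl, rfl⟩ := heq
        obtain ⟨w', h1, h2⟩ := exists_ge_of_swap (q := [d]) le_rfl h
        exact List.cons_le_cons d (h2.trans (ih hx' h1))

end IsShuffle

/-! ### Lyndon words -/

section Lyndon

variable {α : Type*} [LinearOrder α]

/-- Either `s` runs out first, or the comparison is decided at a differing letter, and then no
extension changes it. -/
theorem List.prefix_or_append_lt_append {s t : List α} (h : s < t) :
    s <+: t ∨ ∀ u v : List α, s ++ u < t ++ v := by
  induction s generalizing t with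
  | nil => exact Or.inl List.nil_prefix
  | cons a s ih =>
    cases t with
    | nil => simp at h
    | cons b t =>
      rcases List.cons_lt_cons_iff.1 h with hab | ⟨rfl, hst⟩
      · exact Or.inr fun u v => List.cons_lt_cons_iff.2 (Or.inl hab)
      · rcases ih hst with h | h
        · exact Or.inl (by simpa using h)
        · exact Or.inr fun u v => List.cons_lt_cons_iff.2 (Or.inr ⟨rfl, h u v⟩)

theorem List.append_lt_append_iff_left (u : List α) {s t : List α} :
    u ++ s < u ++ t ↔ s < t := by
  induction u with
  | nil => rfl
  | cons a u ih => simp only [List.cons_append, List.cons_lt_cons_self, ih]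

theorem List.append_le_append_iff_left' (u : List α) {s t : List α} :
    u ++ s ≤ u ++ t ↔ s ≤ t := by
  rw [← not_lt, ← not_lt, List.append_lt_append_iff_left]

theorem List.le_append_right' (s t : List α) : s ≤ s ++ t := by
  have h := (List.append_le_append_iff_left' s (s := []) (t := t)).2 (not_lt.1 (List.not_lt_nil t))
  simpa using h

/-- A Lyndon word is strictly smaller than its proper nonempty suffixes. -/
theorem IsLyndonWord.lt_suffix {w u v : List α} (hw : IsLyndonWord w) (huv : w = u ++ v)
    (hu : u ≠ []) (hv : v ≠ []) : w < v := by
  have hul := List.length_pos_iff.2 hu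
  have hvl := List.length_pos_iff.2 hv
  have h1 : w < v ++ u := by
    have := hw.2 u.length hul (by simp [huv, hvl])
    rwa [huv, List.rotate_append_length_eq, ← huv] at this
  by_contra hlt
  have hne : v ≠ w := by
    rintro rfl
    have := congrArg List.length huv
    simp only [List.length_append] at this
    omega
  -- Suppose `v < w`. If a letter decides this, then `v ++ u < w`, against the rotation inequality
  -- `h1`. Otherwise `w = v ++ t`, and `h1` gives `t < u` with equal lengths, so `t ++ v < u ++ v =
  -- w`, against the rotation by `v.length`.
  rcases List.prefix_or_append_lt_append (lt_of_le_of_ne (not_lt.1 hlt) hne) with ⟨t, ht⟩ | h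
  · have htl : t.length = u.length := by
      have := congrArg List.length (ht.trans huv)
      simp only [List.length_append] at this
      omega
    have htu : t < u := by rwa [← ht, List.append_lt_append_iff_left] at h1
    have h2 : w < t ++ v := by
      have := hw.2 v.length hvl (by rw [← ht]; simp; omega)
      rwa [← ht, List.rotate_append_length_eq, ht] at this
    rcases List.prefix_or_append_lt_append htu with h | h
    · exact htu.ne (h.eq_of_length htl)
    · have h3 := h v v
      rw [← huv] at h3
      exact lt_asymm h2 h3
  · have := h u []
    rw [List.append_nil] at this
    exact lt_asymm h1 this

theorem IsLyndonWord.le_suffix {w v : List α} (hw : IsLyndonWord w) (h : v <:+ w)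
    (hv : v ≠ []) : w ≤ v := by
  obtain ⟨u, rfl⟩ := h
  by_cases hu : u = []
  · simp [hu]
  · exact (hw.lt_suffix rfl hu hv).le

/-- The weak inequality suffices: a proper suffix differs from `w` in length, and a rotation extends
a suffix to the right, which only increases it. -/
theorem isLyndonWord_of_lt_suffix {w : List α} (h0 : w ≠ [])
    (h : ∀ v, v <:+ w → v ≠ [] → w ≤ v) : IsLyndonWord w := by
  refine ⟨h0, fun i hi hil => ?_⟩
  rw [List.rotate_eq_drop_append_take hil.le]
  have hd : w.drop i ≠ [] := by simpa using hil
  have hne : w ≠ w.drop i := fun h' => by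
    have := congrArg List.length h'
    rw [List.length_drop] at this
    omega
  exact (lt_of_le_of_ne (h _ (List.drop_suffix i w) hd) hne).trans_le
    (List.le_append_right' _ _)

/-! ### Existence and uniqueness of the Lyndon factorization. -/

/-- The last factor of a nonincreasing product of Lyndon words is its smallest nonempty suffix. -/
theorem getLast_le_suffix_flatten {M : List (List α)} {l s : List α}
    (hM : ∀ x ∈ M, IsLyndonWord x) (hl : ∀ x ∈ M, l ≤ x)
    (hs : s <:+ M.flatten) (h0 : s ≠ []) : l ≤ s := by
  induction M with
  | nil => simp at hs; exact absurd hs h0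
  | cons x M ih =>
    rw [List.flatten_cons] at hs
    simp only [List.mem_cons, forall_eq_or_imp] at hM hl
    obtain ⟨p, hp⟩ := hs
    -- The suffix either begins inside `x`, and is then `t ++ M.flatten` with `t` a suffix of `x`,
    -- or lies within `M.flatten`.
    rcases List.append_eq_append_iff.1 hp with ⟨t, hx, rfl⟩ | ⟨t, -, ht⟩
    · have hs : t <:+ x := ⟨p, hx.symm⟩
      by_cases ht : t = []
      · subst ht
        exact ih hM.2 hl.2 List.suffix_rfl
      · exact (hl.1.trans (hM.1.le_suffix hs ht)).trans (List.le_append_right' _ _)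
    · exact ih hM.2 hl.2 ⟨t, ht.symm⟩

/-- The smallest nonempty suffix `v` of `w` is Lyndon, because its own suffixes are suffixes of `w`.
It is split off as the last factor, and the rest is factored by induction. -/
theorem exists_lyndon_factorization (w : List α) : ∃ M : List (List α),
    (∀ x ∈ M, IsLyndonWord x) ∧ M.Pairwise (· ≥ ·) ∧ M.flatten = w := by
  induction hn : w.length using Nat.strong_induction_on generalizing w with
  | _ n ih =>
    by_cases hw : w = []
    · exact ⟨[], by simp, by simp, hw.symm⟩
    have hfin : {s : List α | s <:+ w ∧ s ≠ []}.Finite :=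
      (w.tails.finite_toSet).subset fun s hs => (List.mem_tails s w).2 hs.1
    obtain ⟨v, ⟨⟨u, rfl⟩, hv0⟩, hmin⟩ :=
      Set.exists_min_image _ id hfin ⟨w, List.suffix_rfl, hw⟩
    replace hmin : ∀ s, s <:+ u ++ v → s ≠ [] → v ≤ s := fun s h1 h2 => hmin s ⟨h1, h2⟩
    have hvL : IsLyndonWord v := isLyndonWord_of_lt_suffix hv0 fun s hs h0 =>
      hmin s (hs.trans (List.suffix_append u v)) h0
    have hul : u.length < n := by
      have := List.length_pos_iff.2 hv0
      simp only [List.length_append] at hn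
      omega
    obtain ⟨M, hM, hdesc, rfl⟩ := ih u.length hul u rfl
    refine ⟨M ++ [v], ?_, ?_, by simp⟩
    · intro x hx
      rcases List.mem_append.1 hx with hx | hx
      · exact hM x hx
      · rw [List.mem_singleton.1 hx]
        exact hvL
    · refine List.pairwise_append.2 ⟨hdesc, by simp, ?_⟩
      rcases List.eq_nil_or_concat M with rfl | ⟨N, l, rfl⟩
      · simp
      -- If `l < v`, minimality of `v` gives `v ≤ l ++ v`. When `v = l ++ z`, cancelling `l` gives
      -- `z ≤ v`, impossible for a proper suffix of a Lyndon word; otherwise a differing letter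
      -- gives `l ++ v < v`.
      · have hlv : v ≤ l := by
          by_contra hlt
          have hlt := not_le.1 hlt
          have hle : v ≤ l ++ v := hmin _ ⟨N.flatten, by simp⟩ (by simp [hv0])
          rcases List.prefix_or_append_lt_append hlt with ⟨z, rfl⟩ | h
          · have hz : z ≠ [] := fun hz => hlt.ne (by simp [hz])
            have hl0 : l ≠ [] := (hM l (by simp)).1
            rw [List.append_le_append_iff_left'] at hle
            exact (hvL.lt_suffix rfl hl0 hz).not_ge hle
          · have := h v []
            rw [List.append_nil] at this
            exact this.not_ge hle
        intro x hx y hy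
        rw [List.mem_singleton.1 hy]
        rw [List.concat_eq_append] at hx hdesc
        rcases List.mem_append.1 hx with hx | hx
        · exact hlv.trans ((List.pairwise_append.1 hdesc).2.2 x hx l (by simp))
        · rw [List.mem_singleton.1 hx]
          exact hlv

/-- The last factor of either product is the smallest nonempty suffix of the common word, so the
last factors agree and can be cancelled. -/
theorem lyndon_factorization_unique {M N : List (List α)} (hM : ∀ x ∈ M, IsLyndonWord x)
    (hN : ∀ x ∈ N, IsLyndonWord x) (hMd : M.Pairwise (· ≥ ·)) (hNd : N.Pairwise (· ≥ ·))
    (h : M.flatten = N.flatten) : M = N := by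
  induction M using List.reverseRecOn generalizing N with
  | nil =>
    cases N with
    | nil => rfl
    | cons x N =>
      have h' : x = [] ∧ ∀ y ∈ N, y = [] := by simpa using h.symm
      exact absurd h'.1 (hN x (by simp)).1
  | append_singleton M l ih =>
    rcases List.eq_nil_or_concat N with rfl | ⟨N, k, rfl⟩
    · have h' : (∀ y ∈ M, y = []) ∧ l = [] := by simpa using h
      exact absurd h'.2 (hM l (by simp)).1
    rw [List.concat_eq_append] at hN hNd h ⊢
    have hlast : ∀ {P : List (List α)} {p s : List α}, (∀ x ∈ P ++ [p], IsLyndonWord x) →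
        (P ++ [p]).Pairwise (· ≥ ·) → s <:+ (P ++ [p]).flatten → s ≠ [] → p ≤ s := by
      intro P p s hP hPd
      refine getLast_le_suffix_flatten hP fun x hx => ?_
      rcases List.mem_append.1 hx with hx | hx
      · exact (List.pairwise_append.1 hPd).2.2 x hx p (by simp)
      · exact (List.mem_singleton.1 hx).ge
    have h1 : l ≤ k := hlast hM hMd (h ▸ ⟨N.flatten, by simp⟩) (hN k (by simp)).1
    have h2 : k ≤ l := hlast hN hNd (h ▸ ⟨M.flatten, by simp⟩) (hM l (by simp)).1
    obtain rfl := le_antisymm h1 h2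
    simp only [List.flatten_append, List.flatten_singleton, List.append_cancel_right_eq] at h
    rw [ih (fun x hx => hM x (by simp [hx])) (fun x hx => hN x (by simp [hx]))
      (List.pairwise_append.1 hMd).1 (List.pairwise_append.1 hNd).1 h]

end Lyndon

namespace SetPartition

/-! ### Splitting and restriction -/

theorem split_concat {L : List SetPartition} (hL : ∀ a ∈ L, a.IsAtomic) : (concat L).split = L :=
  split_unique (fun _ => isAtomic_of_mem_split) hL (concat_split _)

theorem split_slash (A B : SetPartition) : (slash A B).split = A.split ++ B.split := by
  have h : slash A B = concat (A.split ++ B.split) := by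
    rw [concat_append, concat_split, concat_split]
  rw [h, split_concat]
  intro a ha
  rcases List.mem_append.1 ha with h | h
  · exact isAtomic_of_mem_split h
  · exact isAtomic_of_mem_split h

theorem split_empty : empty.split = [] := split_concat (L := []) (by simp)

theorem IsAtomic.split_eq {A : SetPartition} (hA : A.IsAtomic) : A.split = [A] := by
  have := split_concat (L := [A]) (by simpa using hA)
  rwa [show concat [A] = A from slash_empty A] at this

theorem split_injective : Function.Injective split := fun A B h => by
  rw [← concat_split A, h, concat_split]

theorem split_length_pos {A : SetPartition} (hA : A.parts ≠ ∅) : 0 < A.split.length := by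
  refine List.length_pos_iff.2 fun h => hA ?_
  rw [← concat_split A, h]
  rfl

theorem restrict_parts (A : SetPartition) : A.restrict A.parts = A := NCSymDual.restrict_self A

theorem restrict_empty (A : SetPartition) : A.restrict ∅ = empty := by
  apply ext_parts
  rw [parts_restrict (Finset.empty_subset _)]
  rfl

theorem parts_restrict_ne_empty {A : SetPartition} {T : Finset (Finset ℕ)} (hT : T ⊆ A.parts)
    (h : T ≠ ∅) : (A.restrict T).parts ≠ ∅ := by
  rw [parts_restrict hT]
  simpa using h

/-- All entries from `A` precede the shifted entries from `B`. Ranks of the former are therefore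
unaffected by the latter, whose ranks are raised by the size of `A.restrict T`. -/
theorem restrict_slash {A B : SetPartition} {T U : Finset (Finset ℕ)} (hT : T ⊆ A.parts)
    (hU : U ⊆ B.parts) : (slash A B).restrict (T ∪ U.image (Finset.image (· + A.size))) =
      slash (A.restrict T) (B.restrict U) := by
  have hsub : T ∪ U.image (Finset.image (· + A.size)) ⊆ (slash A B).parts :=
    Finset.union_subset_union hT (Finset.image_subset_image hU)
  have hsupp : (T ∪ U.image (Finset.image (· + A.size))).biUnion id =
      T.biUnion id ∪ (U.biUnion id).image (· + A.size) := by
    rw [Finset.union_biUnion, Finset.image_biUnion, Finset.biUnion_image]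
    rfl
  have hTs : ∀ x ∈ T.biUnion id, x ≤ A.size := by
    intro x hx
    obtain ⟨p, hp, hxp⟩ := Finset.mem_biUnion.1 hx
    exact (Finset.mem_Icc.1 (subset_Icc (hT hp) hxp)).2
  have hUs : ∀ x ∈ U.biUnion id, 1 ≤ x := by
    intro x hx
    obtain ⟨p, hp, hxp⟩ := Finset.mem_biUnion.1 hx
    exact (Finset.mem_Icc.1 (subset_Icc (hU hp) hxp)).1
  have hrT : ∀ x ∈ T.biUnion id, rank (T.biUnion id ∪ (U.biUnion id).image (· + A.size)) x =
      rank (T.biUnion id) x := by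
    intro x hx
    have h0 : ((U.biUnion id).image (· + A.size)).filter (· ≤ x) = ∅ := by
      refine Finset.filter_eq_empty_iff.2 fun y hy => ?_
      obtain ⟨z, hz, rfl⟩ := Finset.mem_image.1 hy
      have := hTs x hx
      have := hUs z hz
      omega
    rw [rank, rank, Finset.filter_union, h0, Finset.union_empty]
  have hrU : ∀ x ∈ U.biUnion id,
      rank (T.biUnion id ∪ (U.biUnion id).image (· + A.size)) (x + A.size) =
      rank (U.biUnion id) x + (T.biUnion id).card := by
    intro x hx
    rw [rank, rank, Finset.filter_union, Finset.card_union_of_disjoint, add_comm]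
    · congr 1
      · rw [Finset.filter_image, Finset.card_image_of_injective _ (add_left_injective _)]
        simp only [add_le_add_iff_right]
      · rw [Finset.filter_true_of_mem]
        intro y hy
        have := hTs y hy
        omega
    · rw [Finset.disjoint_left]
      intro y hy hy'
      obtain ⟨z, hz, rfl⟩ := Finset.mem_image.1 (Finset.mem_filter.1 hy').1
      have := hTs _ (Finset.mem_filter.1 hy).1
      have := hUs z hz
      omega
  apply ext_parts
  rw [parts_restrict hsub, hsupp, parts_slash, parts_restrict hT, parts_restrict hU,
    size_restrict hT, Finset.image_union, Finset.image_image, Finset.image_image]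
  congr 1
  · refine Finset.image_congr fun p hp => Finset.image_congr fun x hx => ?_
    exact hrT x (subset_supp hp hx)
  · refine Finset.image_congr fun p hp => ?_
    simp only [Function.comp, Finset.image_image]
    refine Finset.image_congr fun x hx => ?_
    exact hrU x (subset_supp hp hx)

theorem exists_restrict_slash {A B : SetPartition} {T : Finset (Finset ℕ)}
    (hT : T ⊆ (slash A B).parts) : ∃ U ⊆ A.parts, ∃ V ⊆ B.parts,
      (slash A B).restrict T = slash (A.restrict U) (B.restrict V) ∧
      (slash A B).restrict ((slash A B).parts \ T) =
        slash (A.restrict (A.parts \ U)) (B.restrict (B.parts \ V)) := by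
  refine ⟨A.parts.filter (· ∈ T), Finset.filter_subset _ _,
    B.parts.filter (fun p => p.image (· + A.size) ∈ T), Finset.filter_subset _ _, ?_, ?_⟩
  · rw [← restrict_slash (Finset.filter_subset _ _) (Finset.filter_subset _ _)]
    congr 1
    ext p
    have := @hT p
    simp only [parts_slash, Finset.mem_union, Finset.mem_image] at this
    simp only [Finset.mem_union, Finset.mem_image, Finset.mem_filter]
    grind
  · rw [← restrict_slash Finset.sdiff_subset Finset.sdiff_subset]
    congr 1
    ext p
    simp only [parts_slash, Finset.mem_union, Finset.mem_image, Finset.mem_filter,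
      Finset.mem_sdiff]
    grind

/-- The word of atoms of `C` is a shuffle of the words of atoms of two complementary restrictions
of `C`, unless some atom of `C` is cut, in which case `C` has fewer atoms than the restrictions
have together. -/
theorem isShuffle_split_restrict {C : SetPartition} {T : Finset (Finset ℕ)} (hT : T ⊆ C.parts) :
    IsShuffle (C.restrict T).split (C.restrict (C.parts \ T)).split C.split ∨
      C.split.length < (C.restrict T).split.length + (C.restrict (C.parts \ T)).split.length := by
  suffices h : ∀ L : List SetPartition, (∀ a ∈ L, a.IsAtomic) → ∀ T ⊆ (concat L).parts,
      IsShuffle ((concat L).restrict T).split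
        ((concat L).restrict ((concat L).parts \ T)).split L ∨
      L.length < ((concat L).restrict T).split.length +
        ((concat L).restrict ((concat L).parts \ T)).split.length by
    have := h C.split (fun _ => isAtomic_of_mem_split) T (by rwa [concat_split])
    rwa [concat_split] at this
  clear hT T
  intro L hL
  induction L with
  | nil =>
    intro T hT
    have h := size_restrict_add hT
    have h' : (concat []).size = 0 := rfl
    rw [eq_empty (A := (concat []).restrict T) (by omega),
      eq_empty (A := (concat []).restrict ((concat []).parts \ T)) (by omega), split_empty]
    exact Or.inl IsShuffle.nil
  | cons a L ih =>
    intro T hT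
    simp only [List.mem_cons, forall_eq_or_imp] at hL
    change T ⊆ (slash a (concat L)).parts at hT
    obtain ⟨U, hU, V, hV, h1, h2⟩ := exists_restrict_slash hT
    change IsShuffle ((slash a (concat L)).restrict T).split
        ((slash a (concat L)).restrict ((slash a (concat L)).parts \ T)).split _ ∨
      _ < ((slash a (concat L)).restrict T).split.length +
        ((slash a (concat L)).restrict ((slash a (concat L)).parts \ T)).split.length
    rw [h1, h2]
    have ih' := ih hL.2 V hV
    by_cases hU0 : U = ∅
    · subst hU0
      rw [Finset.sdiff_empty, restrict_empty, restrict_parts, empty_slash, split_slash,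
        hL.1.split_eq]
      rcases ih' with h | h
      · exact Or.inl (IsShuffle.right a h)
      · refine Or.inr ?_
        simp only [List.length_append, List.length_cons, List.length_nil]
        omega
    by_cases hU1 : a.parts \ U = ∅
    · obtain rfl : U = a.parts := hU.antisymm (Finset.sdiff_eq_empty_iff_subset.1 hU1)
      rw [hU1, restrict_empty, restrict_parts, empty_slash, split_slash, hL.1.split_eq]
      rcases ih' with h | h
      · exact Or.inl (IsShuffle.left a h)
      · refine Or.inr ?_
        simp only [List.length_append, List.length_cons, List.length_nil]
        omega
    -- Here `a` is cut: both restrictions receive a nonempty piece of it, so at least two atoms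
    -- replace one, while the atoms of `L` account for at least `L.length` more.
    · have h3 := split_length_pos (parts_restrict_ne_empty hU hU0)
      have h4 := split_length_pos (parts_restrict_ne_empty (A := a) Finset.sdiff_subset hU1)
      have h5 : L.length ≤ ((concat L).restrict V).split.length +
          ((concat L).restrict ((concat L).parts \ V)).split.length := by
        rcases ih' with h | h
        · exact h.length_eq.le
        · exact h.le
      refine Or.inr ?_
      simp only [split_slash, List.length_append, List.length_cons]
      omega

/-- This makes the coefficient of `w_{A|B}` in `w_A w_B` a positive integer. -/
theorem exists_restrict_slash_eq (A B : SetPartition) : ∃ T ⊆ (slash A B).parts,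
    (slash A B).restrict T = A ∧ (slash A B).restrict ((slash A B).parts \ T) = B := by
  have hdisj : ∀ p ∈ A.parts, p ∉ B.parts.image (Finset.image (· + A.size)) := by
    intro p hp hp'
    obtain ⟨q, hq, rfl⟩ := Finset.mem_image.1 hp'
    obtain ⟨x, hx⟩ := nonempty_of_mem hq
    have h1 := Finset.mem_Icc.1 (subset_Icc hq hx)
    have h2 := Finset.mem_Icc.1 (subset_Icc hp (Finset.mem_image_of_mem _ hx))
    omega
  refine ⟨A.parts, Finset.subset_union_left, ?_, ?_⟩
  · have := restrict_slash (A := A) (B := B) subset_rfl (Finset.empty_subset _)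
    rwa [Finset.image_empty, Finset.union_empty, restrict_parts, restrict_empty,
      slash_empty] at this
  · have := restrict_slash (A := A) (B := B) (Finset.empty_subset _) subset_rfl
    rw [Finset.empty_union, restrict_parts, restrict_empty, empty_slash] at this
    rwa [parts_slash, Finset.union_sdiff_cancel_left (Finset.disjoint_left.2 hdisj)]

/-! ### The order for which the products of Lyndon generators are triangular -/

/-- Compare first the numbers of atoms, then the words of atoms. -/
def AtomLT (A B : SetPartition) : Prop := List.Shortlex (· < ·) A.split B.split

theorem atomLT_iff {A B : SetPartition} : AtomLT A B ↔ A.split.length < B.split.length ∨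
    A.split.length = B.split.length ∧ A.split < B.split := List.shortlex_def

theorem AtomLT.irrefl (A : SetPartition) : ¬ AtomLT A A := fun h => by
  rcases atomLT_iff.1 h with h | h
  · exact lt_irrefl _ h
  · exact lt_irrefl _ h.2

/-- The lexicographic order on all words in `ℕ` is not well-founded, but only words of equal length
are compared here, and there it agrees with `List.Shortlex`. -/
instance : WellFoundedLT SetPartition := by
  refine ⟨Subrelation.wf (r := InvImage (Prod.Lex (· < ·) (Prod.Lex (· < ·)
    (List.Shortlex (· < ·)))) fun A : SetPartition => (A.size, A.length, A.word)) ?_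
    (InvImage.wf _ (WellFounded.prod_lex wellFounded_lt
      (WellFounded.prod_lex wellFounded_lt (List.Shortlex.wf wellFounded_lt))))⟩
  intro A B h
  rw [InvImage, Prod.lex_def, Prod.lex_def]
  refine (lt_iff.1 h).imp_right fun h' => ⟨h'.1, h'.2.imp_right fun h'' => ⟨h''.1, ?_⟩⟩
  exact List.Shortlex.of_lex (by simp [word, h'.1]) h''.2

theorem wellFounded_atomLT : WellFounded AtomLT :=
  InvImage.wf _ (List.Shortlex.wf wellFounded_lt)

/-- Among the set partitions `C` with complementary restrictions `Y ≤ X` and `B`, the largest one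
is `X | B`, provided that the word of atoms of `B` is at most all suffixes of that of `X`. -/
theorem eq_or_atomLT_slash {C X B : SetPartition} {T : Finset (Finset ℕ)} (hT : T ⊆ C.parts)
    (hB : C.restrict (C.parts \ T) = B)
    (hX : ∀ s, s <:+ X.split → s ≠ [] → B.split ≤ s) :
    (C.restrict T = X → C = slash X B ∨ AtomLT C (slash X B)) ∧
    (AtomLT (C.restrict T) X → AtomLT C (slash X B)) := by
  have h := isShuffle_split_restrict hT
  rw [hB] at h
  rw [atomLT_iff, atomLT_iff, split_slash, List.length_append,
    ← split_injective.eq_iff (b := slash X B), split_slash]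
  constructor
  · rintro rfl
    rcases h with h | h
    · rcases (h.le_append hX).eq_or_lt with h' | h'
      · exact Or.inl h'
      · exact Or.inr (Or.inr ⟨h.length_eq, h'⟩)
    · exact Or.inr (Or.inl h)
  · rintro (hlt | ⟨heq, hlt⟩)
    -- If the restriction has fewer atoms than `X`, then `C` has fewer than `X | B`, whether or not
    -- an atom is cut.
    · refine Or.inl ?_
      rcases h with h | h
      · have := h.length_eq
        omega
      · omega
    · rcases h with h | h
      -- Replacing the word of `C.restrict T` by the larger word of `X` gives a larger shuffle,
      -- still bounded by the word of `X | B`.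
      · obtain ⟨w, h1, h2⟩ := h.exists_gt heq hlt
        exact Or.inr ⟨heq ▸ h.length_eq, h2.trans_le (h1.le_append hX)⟩
      · exact Or.inl (heq ▸ h)

end SetPartition

/-! ### Leading terms -/

namespace NCSymDual

open SetPartition

variable {K : Type*} [Field K]

/-- `w_X` is the leading term of `x`. -/
def HasLeading (x : NCSymDual K) (X : SetPartition) : Prop :=
  coeff x X ≠ 0 ∧ ∀ C, coeff x C ≠ 0 → C = X ∨ AtomLT C X

theorem hasLeading_one : HasLeading (1 : NCSymDual K) empty := by
  simp only [HasLeading, one_def, coeff_w]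
  refine ⟨by simp, fun C hC => Or.inl ?_⟩
  by_contra h
  exact hC (if_neg (Ne.symm h))

/-- The suffix condition makes `X | B` the largest partition obtainable from `X` and `B`, and lower
terms of `x` can only produce strictly smaller ones. -/
theorem HasLeading.mul_w [CharZero K] {x : NCSymDual K} {X B : SetPartition} (hx : HasLeading x X)
    (hX : ∀ s, s <:+ X.split → s ≠ [] → B.split ≤ s) :
    HasLeading (x * w K B) (slash X B) := by
  constructor
  · have h : ∀ T ∈ (slash X B).parts.powerset, coeff x ((slash X B).restrict T) *
        coeff (w K B) ((slash X B).restrict ((slash X B).parts \ T)) =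
        if (slash X B).restrict T = X ∧ (slash X B).restrict ((slash X B).parts \ T) = B
          then coeff x X else 0 := by
      intro T hT
      rw [Finset.mem_powerset] at hT
      rw [coeff_w]
      by_cases hB : (slash X B).restrict ((slash X B).parts \ T) = B
      · by_cases hT' : (slash X B).restrict T = X
        · rw [if_pos hB.symm, if_pos ⟨hT', hB⟩, hT', mul_one]
        · rw [if_neg (c := _ ∧ _) fun h => hT' h.1, if_pos hB.symm, mul_one]
          -- A lower term of `x` contributing to `X | B` would make `X | B` smaller than itself.
          by_contra h0
          rcases hx.2 _ h0 with h | h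
          · exact hT' h
          · exact AtomLT.irrefl _ ((eq_or_atomLT_slash hT hB hX).2 h)
      · rw [if_neg (Ne.symm hB), if_neg fun h => hB h.2, mul_zero]
    rw [coeff_mul, Finset.sum_congr rfl h, ← Finset.sum_filter, Finset.sum_const, nsmul_eq_mul]
    -- Characteristic zero enters here: the leading coefficient of `x` is multiplied by the number
    -- of suitable `T`.
    refine mul_ne_zero (Nat.cast_ne_zero.2 (Finset.card_ne_zero.2 ?_)) hx.1
    obtain ⟨T, hT, h1, h2⟩ := exists_restrict_slash_eq X B
    exact ⟨T, Finset.mem_filter.2 ⟨Finset.mem_powerset.2 hT, h1, h2⟩⟩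
  · intro C hC
    rw [coeff_mul] at hC
    obtain ⟨T, hT, h0⟩ := Finset.exists_ne_zero_of_sum_ne_zero hC
    rw [Finset.mem_powerset] at hT
    have hB : C.restrict (C.parts \ T) = B := by
      by_contra hB
      rw [coeff_w, if_neg (Ne.symm hB), mul_zero] at h0
      exact h0 rfl
    rcases hx.2 _ (left_ne_zero_of_mul h0) with h | h
    · exact (eq_or_atomLT_slash hT hB hX).1 h
    · exact Or.inr ((eq_or_atomLT_slash hT hB hX).2 h)

theorem split_concat_eq_flatten (L : List SetPartition) :
    (concat L).split = (L.map split).flatten := by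
  induction L with
  | nil => exact split_empty
  | cons A L ih =>
    rw [List.map_cons, List.flatten_cons, ← ih, ← split_slash]
    rfl

/-- The leading term of a product of generators `w_A` with `A` Lyndon. -/
theorem hasLeading_prod [CharZero K] {L : List SetPartition} (hL : ∀ A ∈ L, A.IsLyndon)
    (hd : L.Pairwise fun A B => B.split ≤ A.split) :
    HasLeading (L.map (w K)).prod (concat L) := by
  induction L using List.reverseRecOn with
  | nil => exact hasLeading_one
  | append_singleton L B ih =>
    have hd' := List.pairwise_append.1 hd
    have h := ih (fun A hA => hL A (by simp [hA])) hd'.1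
    rw [List.map_append, List.prod_append, List.map_singleton, List.prod_singleton, concat_append,
      show concat [B] = B from slash_empty B]
    -- The factors are nonincreasing, so the word of `B` is at most every nonempty suffix of the
    -- product of the earlier words.
    refine h.mul_w fun s hs h0 => ?_
    rw [split_concat_eq_flatten] at hs
    refine getLast_le_suffix_flatten (fun x hx => ?_) (fun x hx => ?_) hs h0
    · obtain ⟨A, hA, rfl⟩ := List.mem_map.1 hx
      exact hL A (by simp [hA])
    · obtain ⟨A, hA, rfl⟩ := List.mem_map.1 hx
      exact hd'.2.2 A hA B (by simp)

/-! ### Spanning and independence from leading terms. -/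

theorem mem_of_forall_w_mem {S : Submodule K (NCSymDual K)} {x : NCSymDual K}
    (h : ∀ C, coeff x C ≠ 0 → w K C ∈ S) : x ∈ S := by
  rw [← (basis K).linearCombination_repr x, Finsupp.linearCombination_apply]
  exact S.sum_mem fun C hC => S.smul_mem _ (h C (Finsupp.mem_support_iff.1 hC))

/-- If every set partition is the leading term of an element of a submodule, then this submodule
is everything. -/
theorem eq_top_of_hasLeading {S : Submodule K (NCSymDual K)}
    (h : ∀ X, ∃ x ∈ S, HasLeading x X) : S = ⊤ := by
  have hw : ∀ X, w K X ∈ S := by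
    intro X
    induction X using wellFounded_atomLT.induction with
    | _ X ih =>
      obtain ⟨x, hxS, hx⟩ := h X
      -- Removing the leading term leaves only smaller `w_C`, which lie in `S` by induction.
      have hy : x - coeff x X • w K X ∈ S := by
        refine mem_of_forall_w_mem fun C hC => ?_
        rw [← coeffHom_apply, map_sub, map_smul, coeffHom_apply, coeffHom_apply, coeff_w] at hC
        by_cases hCX : X = C
        · subst hCX
          simp at hC
        · rw [if_neg hCX, smul_zero, sub_zero] at hC
          exact ih C ((hx.2 C hC).resolve_left (Ne.symm hCX))
      have := S.sub_mem hxS hy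
      rw [sub_sub_cancel] at this
      exact (S.smul_mem_iff hx.1).1 this
  exact eq_top_iff.2 fun x _ => mem_of_forall_w_mem fun C _ => hw C

/-- Elements with distinct leading terms are linearly independent. -/
theorem linearIndependent_of_hasLeading {ι : Type*} {v : ι → NCSymDual K} {φ : ι → SetPartition}
    (hφ : Function.Injective φ) (h : ∀ i, HasLeading (v i) (φ i)) : LinearIndependent K v := by
  rw [linearIndependent_iff']
  by_contra! hne
  obtain ⟨s, g, hsum, i₀, hi₀, hg₀⟩ := hne
  classical
  -- Among the indices with nonzero coefficient, take the one with the largest leading term; no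
  -- other summand involves that basis element.
  obtain ⟨i, hi, hmax⟩ := Finset.exists_max_image (s.filter fun i => g i ≠ 0)
    (fun i => toLex ((φ i).split.length, (φ i).split)) ⟨i₀, Finset.mem_filter.2 ⟨hi₀, hg₀⟩⟩
  rw [Finset.mem_filter] at hi
  have h0 := congrArg (coeffHom (φ i)) hsum
  rw [map_sum, map_zero, Finset.sum_eq_single i] at h0
  · rw [map_smul, coeffHom_apply, smul_eq_mul] at h0
    exact mul_ne_zero hi.2 (h i).1 h0
  · intro j hj hji
    rw [map_smul, coeffHom_apply, smul_eq_mul, mul_eq_zero]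
    by_contra! hne
    rcases (h j).2 _ hne.2 with h' | h'
    · exact hji (hφ h').symm
    · have := hmax j (Finset.mem_filter.2 ⟨hj, hne.1⟩)
      exact this.not_gt (Prod.Lex.toLex_lt_toLex.2 (atomLT_iff.1 h'))
  · exact fun h' => absurd hi.1 h'

end NCSymDual

/-! ### Multisets of Lyndon set partitions -/

namespace SetPartition

/-- `lyndonGE A B`: the word of atoms of `A` is at least that of `B`. -/
def lyndonGE (A B : {B : SetPartition // B.IsLyndon}) : Prop := B.1.split ≤ A.1.split

noncomputable instance : DecidableRel lyndonGE := Classical.decRel _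

instance : IsTrans _ lyndonGE := ⟨fun _ _ _ h h' => le_trans h' h⟩

instance : Std.Antisymm lyndonGE :=
  ⟨fun _ _ h h' => Subtype.ext (split_injective (le_antisymm h' h))⟩

instance : Std.Total lyndonGE := ⟨fun _ _ => le_total _ _⟩

/-- The set partition `A₁ | ⋯ | Aₖ` for the Lyndon set partitions `A₁ ≥ ⋯ ≥ Aₖ` in a multiset. -/
noncomputable def ofLyndon (m : Multiset {B : SetPartition // B.IsLyndon}) : SetPartition :=
  concat ((m.sort lyndonGE).map Subtype.val)

/-- The word of atoms of `ofLyndon m` has the sorted words of `m` as its Lyndon factorization, which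
is unique. -/
theorem ofLyndon_injective : Function.Injective ofLyndon := by
  intro m m' h
  have hL : ∀ m : Multiset {B : SetPartition // B.IsLyndon},
      ∀ x ∈ ((m.sort lyndonGE).map Subtype.val).map split, IsLyndonWord x := by
    intro m x hx
    obtain ⟨A, hA, rfl⟩ := List.mem_map.1 hx
    obtain ⟨B, -, rfl⟩ := List.mem_map.1 hA
    exact B.2
  have hd : ∀ m : Multiset {B : SetPartition // B.IsLyndon},
      (((m.sort lyndonGE).map Subtype.val).map split).Pairwise (· ≥ ·) := by
    intro m
    rw [List.pairwise_map, List.pairwise_map]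
    exact m.pairwise_sort lyndonGE
  have h1 := congrArg split h
  rw [ofLyndon, ofLyndon, NCSymDual.split_concat_eq_flatten,
    NCSymDual.split_concat_eq_flatten] at h1
  have h2 := lyndon_factorization_unique (hL m) (hL m') (hd m) (hd m') h1
  have h3 := Subtype.val_injective.list_map (split_injective.list_map h2)
  rw [← m.sort_eq lyndonGE, h3, m'.sort_eq]

theorem ofLyndon_surjective : Function.Surjective ofLyndon := by
  intro A
  obtain ⟨M, hM, hd, hA⟩ := exists_lyndon_factorization A.split
  -- Letters of a Lyndon factor of `A.split` are atoms of `A`, so each factor is the word of atoms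
  -- of a Lyndon set partition.
  have hs : ∀ x ∈ M, (concat x).split = x := fun x hx => split_concat fun a ha =>
    isAtomic_of_mem_split (hA ▸ List.mem_flatten.2 ⟨x, hx, ha⟩)
  let L : List {B : SetPartition // B.IsLyndon} := M.attach.map fun x =>
    ⟨concat x.1, by rw [IsLyndon, hs x.1 x.2]; exact hM x.1 x.2⟩
  have hLM : (L.map Subtype.val).map split = M := by
    rw [List.map_map, List.map_map]
    conv_rhs => rw [← List.attach_map_subtype_val M]
    exact List.map_congr_left fun x _ => hs x.1 x.2
  have hLd : L.Pairwise lyndonGE := by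
    rw [← hLM, List.pairwise_map, List.pairwise_map] at hd
    exact hd
  refine ⟨(L : Multiset _), ?_⟩
  have hsort : (L : Multiset _).sort lyndonGE = L :=
    List.Perm.eq_of_pairwise' (r := lyndonGE) (Multiset.pairwise_sort _ _) hLd
      (Multiset.coe_eq_coe.1 (Multiset.sort_eq _ _))
  rw [ofLyndon, hsort]
  apply split_injective
  rw [NCSymDual.split_concat_eq_flatten, hLM, hA]

end SetPartition

/-! ### Monomials in the generators and the main theorem. -/

open SetPartition NCSymDual in
theorem hasLeading_monomial {K : Type*} [Field K] [CharZero K]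
    (m : {B : SetPartition // B.IsLyndon} →₀ ℕ) :
    HasLeading (m.prod fun B k => w K B.1 ^ k) (ofLyndon (Finsupp.toMultiset m)) := by
  have h := hasLeading_prod (K := K)
    (L := ((Finsupp.toMultiset m).sort lyndonGE).map Subtype.val)
    (by
      intro A hA
      obtain ⟨B, -, rfl⟩ := List.mem_map.1 hA
      exact B.2)
    (by
      rw [List.pairwise_map]
      exact Multiset.pairwise_sort _ lyndonGE)
  -- By commutativity the factors of a monomial may be taken in sorted order.
  have h2 : ((((Finsupp.toMultiset m).sort lyndonGE).map Subtype.val).map (w K)).prod =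
      m.prod fun B k => w K B.1 ^ k := by
    rw [List.map_map, ← Multiset.prod_coe, ← Multiset.map_coe, Multiset.sort_eq,
      Finsupp.toMultiset_map, Finsupp.prod_toMultiset,
      Finsupp.prod_mapDomain_index (by simp) (by simp [pow_add])]
    rfl
  rwa [h2] at h

theorem mainTheorem3 (K : Type*) [Field K] [CharZero K] :
    AlgebraicIndependent K
      (fun B : {B : SetPartition // B.IsLyndon} => NCSymDual.w K (B : SetPartition)) ∧
    Algebra.adjoin K
      (Set.range (fun B : {B : SetPartition // B.IsLyndon} => NCSymDual.w K (B : SetPartition))) =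
        ⊤ := by
  -- Exponent vectors correspond to multisets, so distinct monomials have distinct leading terms.
  have hind : LinearIndependent K
      fun m : {B : SetPartition // B.IsLyndon} →₀ ℕ => m.prod fun B k => NCSymDual.w K B.1 ^ k :=
    NCSymDual.linearIndependent_of_hasLeading
      (SetPartition.ofLyndon_injective.comp (Function.LeftInverse.injective Finsupp.toMultiset_toFinsupp)) hasLeading_monomial
  constructor
  · rw [algebraicIndependent_iff]
    intro p hp
    rw [MvPolynomial.aeval_def, MvPolynomial.eval₂_eq] at hp
    rw [linearIndependent_iff'] at hind
    ext m
    by_cases hm : m ∈ p.support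
    · refine hind p.support (fun m => p.coeff m) ?_ m hm
      rw [← hp]
      refine Finset.sum_congr rfl fun m _ => ?_
      rw [Algebra.smul_def]
      rfl
    · simpa using hm
  · rw [← Algebra.toSubmodule_eq_top]
    refine NCSymDual.eq_top_of_hasLeading fun X => ?_
    -- The monomial with leading term `X` is read off from the Lyndon factorization of its word of
    -- atoms.
    obtain ⟨s, rfl⟩ := SetPartition.ofLyndon_surjective X
    rw [← Multiset.toFinsupp_toMultiset s]
    refine ⟨_, ?_, hasLeading_monomial _⟩
    exact Subalgebra.prod_mem _ fun B _ =>
      Subalgebra.pow_mem _ (Algebra.subset_adjoin (Set.mem_range_self B)) _
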